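/- Setting. Let $m$ agents observe subsets of the $d$ coordinates of feature vectors in $\mathbb{R}^d$. Agent $i$ observes $d_i$ coordinates; for $v\in\mathbb{R}^d$ write $v_{i+}\in\mathbb{R}^{d_i}$ and $v_{i-}\in\mathbb{R}^{d-d_i}$ for the observed and unobserved parts, i.e. $v_{i+}=\Pi_{i+}v$, $v_{i-}=\Pi_{i-}v$, where $\Pi_i=\begin{bmatrix}\Pi_{i+}\\ \Pi_{i-}\end{bmatrix}$ is a permutation matrix, and for $A\in\mathbb{R}^{d\times d}$ write $A_{i+}=\Pi_{i+}A\Pi_{i+}^\top$, $A_{i-}=\Pi_{i-}A\Pi_{i-}^\top$, $A_{i\pm}=\Pi_{i+}A\Pi_{i-}^\top$, $A_{i\mp}=\Pi_{i-}A\Pi_{i+}^\top$. Assume that every coordinate is observed by at least one agent. Let $\Sigma\succ0$, $\theta\in\mathbb{R}^d$ and $\sigma\ge 0$ be fixed, and set $\|v\|_A^2=\langle v,Av\rangle$, $$T_i=\begin{bmatrix} I_{d_i} & \Sigma_{i+}^{-1}\Sigma_{i\pm}\end{bmatrix}\Pi_i,\qquad \Gamma_{i-}=\Sigma_{i-}-\Sigma_{i\mp}\Sigma_{i+}^{-1}\Sigma_{i\pm},\qquad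 W_i^{\mathrm g}=\frac{\Sigma_{i+}}{\|\theta_{i-}\|_{\Gamma_{i-}}^2+\sigma^2},\qquad C^{\mathrm g}=\Bigl(\sum_{i=1}^m T_i^\top W_i^{\mathrm g}T_i\Bigr)^{-1},$$ where $\|\theta_{i-}\|_{\Gamma_{i-}}^2+\sigma^2>0$ is assumed for all $i$ (automatic if $\sigma>0$). Agent $i$ has $n$ samples: the rows of $X_i\in\mathbb{R}^{n\times d}$ are $\mathsf N(0,\Sigma)$, $y_i=X_i\theta+\xi_i$ with $\xi_i\sim\mathsf N(0,\sigma^2I_n)$, and all feature vectors and noise variables, within and across agents, are independent. Let $X_{i+}$ be the observed columns of $X_i$, and let $$\hat\theta_i=(X_{i+}^\top X_{i+})^{-1}X_{i+}^\top y_i,\qquad R_i=\tfrac1n\|X_{i+}\hat\theta_i-y_i\|_2^2,\qquad \hat\Sigma_{i+}=\tfrac1nX_{i+}^\top X_{i+}.$$ For positive definite $W_i\in\mathbb{R}^{d_i\times d_i}$ let $$\hat\theta(W_1,\dots,W_m)=\operatorname*{argmin}_{t\in\mathbb{R}^d}\sum_{i=1}^m\bigl\|t_{i+}+\Sigma_{i+}^{-1}\Sigma_{i\pm}t_{i-}-\hat\theta_i\bigr\|_{W_i}^2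 ,$$ $$C(W_1,\dots,W_m)=\Bigl(\sum_i T_i^\top W_iT_i\Bigr)^{-1}\Bigl(\sum_i T_i^\top W_i(W_i^{\mathrm g})^{-1}W_iT_i\Bigr)\Bigl(\sum_i T_i^\top W_iT_i\Bigr)^{-1}.$$ The Collab estimators are $\hat\theta^{\mathrm{clb}}=\hat\theta(\hat W_1,\dots,\hat W_m)$ and $\hat\theta_i^{\mathrm{clb}}=T_i\hat\theta^{\mathrm{clb}}$, where either $\hat W_i=\hat\Sigma_{i+}/R_i$ for all $i$ or $\hat W_i=\Sigma_{i+}/R_i$ for all $i$. Claim. For either choice of $\hat W_i$, the probability that all $\hat W_i$ are positive definite tends to $1$ and, as $n\to\infty$, $$\sqrt n\,(\hat\theta^{\mathrm{clb}}-\theta)\xrightarrow{d}\mathsf N(0,C^{\mathrm g}),\qquad \sqrt n\,(\hat\theta_i^{\mathrm{clb}}-T_i\theta)\xrightarrow{d}\mathsf N(0,T_iC^{\mathrm g}T_i^\top)\quad\text{for every } i .$$ (These limits do not depend on how $\hat\theta^{\mathrm{clb}}$ is defined, measurably, where some $\hat W_i$ is not positive definite.) Moreover: (i) For all fixed positive definite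 $W_1,\dots,W_m$, the matrix $\sum_iT_i^\top W_iT_i$ is positive definite, the argmin is unique, $\sqrt n\,(\hat\theta(W_1,\dots,W_m)-\theta)\xrightarrow{d}\mathsf N(0,C(W_1,\dots,W_m))$, and $$C(W_1,\dots,W_m)\succeq C(W_1^{\mathrm g},\dots,W_m^{\mathrm g})=C^{\mathrm g};$$ the $W_i^{\mathrm g}$ are themselves positive definite, so they are the optimal weights. (ii) For every $i$, $\sqrt n\,(\hat\theta_i-T_i\theta)\xrightarrow{d}\mathsf N(0,(W_i^{\mathrm g})^{-1})$, and $(W_i^{\mathrm g})^{-1}\succeq T_iC^{\mathrm g}T_i^\top$. -/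

import Mathlib

open MeasureTheory ProbabilityTheory Filter Topology Matrix
open scoped NNReal

noncomputable section

namespace Collab

section OneAgent

/-! An agent's view is a bijection `e : Fin p ⊕ Fin q ≃ Fin d`: `e (Sum.inl a)` is its `a`-th
observed coordinate, `e (Sum.inr b)` its `b`-th unobserved coordinate.  It is the permutation
matrix with block rows `Π₊` (observed) and `Π₋` (unobserved). -/

variable {p q d n : ℕ}

/-- The observed part `v₊ = Π₊ v`. -/
def obs (e : Fin p ⊕ Fin q ≃ Fin d) (v : Fin d → ℝ) : Fin p → ℝ := fun a => v (e (Sum.inl a))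

/-- The unobserved part `v₋ = Π₋ v`. -/
def unobs (e : Fin p ⊕ Fin q ≃ Fin d) (v : Fin d → ℝ) : Fin q → ℝ := fun b => v (e (Sum.inr b))

/-- `A₊ = Π₊ A Π₊ᵀ`. -/
def blockPP (e : Fin p ⊕ Fin q ≃ Fin d) (A : Matrix (Fin d) (Fin d) ℝ) :
    Matrix (Fin p) (Fin p) ℝ :=
  A.submatrix (fun a => e (Sum.inl a)) (fun a => e (Sum.inl a))

/-- `A± = Π₊ A Π₋ᵀ`. -/
def blockPM (e : Fin p ⊕ Fin q ≃ Fin d) (A : Matrix (Fin d) (Fin d) ℝ) :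
    Matrix (Fin p) (Fin q) ℝ :=
  A.submatrix (fun a => e (Sum.inl a)) (fun b => e (Sum.inr b))

/-- `A∓ = Π₋ A Π₊ᵀ`. -/
def blockMP (e : Fin p ⊕ Fin q ≃ Fin d) (A : Matrix (Fin d) (Fin d) ℝ) :
    Matrix (Fin q) (Fin p) ℝ :=
  A.submatrix (fun b => e (Sum.inr b)) (fun a => e (Sum.inl a))

/-- `A₋ = Π₋ A Π₋ᵀ`. -/
def blockMM (e : Fin p ⊕ Fin q ≃ Fin d) (A : Matrix (Fin d) (Fin d) ℝ) :
    Matrix (Fin q) (Fin q) ℝ :=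
  A.submatrix (fun b => e (Sum.inr b)) (fun b => e (Sum.inr b))

/-- `T = [I  Σ₊⁻¹ Σ±] Π`. -/
def transfer (e : Fin p ⊕ Fin q ≃ Fin d) (S : Matrix (Fin d) (Fin d) ℝ) :
    Matrix (Fin p) (Fin d) ℝ :=
  (Matrix.fromCols (1 : Matrix (Fin p) (Fin p) ℝ)
    ((blockPP e S)⁻¹ * blockPM e S)).submatrix id e.symm

/-- The Schur complement `Γ₋ = Σ₋ - Σ∓ Σ₊⁻¹ Σ±`. -/
def schur (e : Fin p ⊕ Fin q ≃ Fin d) (S : Matrix (Fin d) (Fin d) ℝ) :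
    Matrix (Fin q) (Fin q) ℝ :=
  blockMM e S - blockMP e S * (blockPP e S)⁻¹ * blockPM e S

/-- The quadratic form `‖v‖²_A = ⟨v, A v⟩`. -/
def quad {k : ℕ} (A : Matrix (Fin k) (Fin k) ℝ) (v : Fin k → ℝ) : ℝ := v ⬝ᵥ (A *ᵥ v)

/-- `‖θ₋‖²_{Γ₋} + σ²`. -/
def residualVariance (e : Fin p ⊕ Fin q ≃ Fin d) (S : Matrix (Fin d) (Fin d) ℝ)
    (θ : Fin d → ℝ) (σ : ℝ≥0) : ℝ :=
  quad (schur e S) (unobs e θ) + (σ : ℝ) ^ 2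

/-- `Wᵍ = Σ₊ / (‖θ₋‖²_{Γ₋} + σ²)`. -/
def gaussianWeight (e : Fin p ⊕ Fin q ≃ Fin d) (S : Matrix (Fin d) (Fin d) ℝ)
    (θ : Fin d → ℝ) (σ : ℝ≥0) : Matrix (Fin p) (Fin p) ℝ :=
  (residualVariance e S θ σ)⁻¹ • blockPP e S

/-- The observed columns `X₊` of a full data matrix `X`. -/
def obsData (e : Fin p ⊕ Fin q ≃ Fin d) (X : Matrix (Fin n) (Fin d) ℝ) :
    Matrix (Fin n) (Fin p) ℝ :=
  X.submatrix id (fun a => e (Sum.inl a))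

/-- Ordinary least squares `(AᵀA)⁻¹ Aᵀ y`. -/
def ols (A : Matrix (Fin n) (Fin p) ℝ) (y : Fin n → ℝ) : Fin p → ℝ :=
  (Aᵀ * A)⁻¹ *ᵥ (Aᵀ *ᵥ y)

/-- The training error `(1/n) ‖A θ̂ - y‖²` of ordinary least squares. -/
def trainError (A : Matrix (Fin n) (Fin p) ℝ) (y : Fin n → ℝ) : ℝ :=
  (n : ℝ)⁻¹ * ∑ j, ((A *ᵥ ols A y) j - y j) ^ 2

/-- The sample second-moment matrix `(1/n) AᵀA`. -/
def sampleCov (A : Matrix (Fin n) (Fin p) ℝ) : Matrix (Fin p) (Fin p) ℝ :=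
  (n : ℝ)⁻¹ • (Aᵀ * A)

end OneAgent

section Samples

variable {Ω : Type*} {d : ℕ}

/-- The `n × d` matrix whose rows are the first `n` feature vectors. -/
def dataMatrix (x : ℕ → Ω → EuclideanSpace ℝ (Fin d)) (n : ℕ) (ω : Ω) :
    Matrix (Fin n) (Fin d) ℝ :=
  Matrix.of fun j k => x j ω k

/-- The labels `y = X θ + ξ` of the first `n` samples. -/
def labels (θ : Fin d → ℝ) (x : ℕ → Ω → EuclideanSpace ℝ (Fin d)) (ξ : ℕ → Ω → ℝ)
    (n : ℕ) (ω : Ω) : Fin n → ℝ :=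
  dataMatrix x n ω *ᵥ θ + fun j : Fin n => ξ j ω

/-- The local least squares estimate computed by an agent with view `e` from `n` samples. -/
def localOLS {p q : ℕ} (e : Fin p ⊕ Fin q ≃ Fin d) (θ : Fin d → ℝ)
    (x : ℕ → Ω → EuclideanSpace ℝ (Fin d)) (ξ : ℕ → Ω → ℝ) (n : ℕ) (ω : Ω) : Fin p → ℝ :=
  ols (obsData e (dataMatrix x n ω)) (labels θ x ξ n ω)

/-- The training error `R` of the local least squares estimate. -/
def localError {p q : ℕ} (e : Fin p ⊕ Fin q ≃ Fin d) (θ : Fin d → ℝ)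
    (x : ℕ → Ω → EuclideanSpace ℝ (Fin d)) (ξ : ℕ → Ω → ℝ) (n : ℕ) (ω : Ω) : ℝ :=
  trainError (obsData e (dataMatrix x n ω)) (labels θ x ξ n ω)

/-- Convergence in distribution of the random vectors `Z n` to `N(0, C)`. -/
def TendstoNormal [MeasurableSpace Ω] (P : Measure Ω) [IsProbabilityMeasure P] {k : ℕ}
    (Z : ℕ → Ω → Fin k → ℝ) (C : Matrix (Fin k) (Fin k) ℝ) : Prop :=
  TendstoInDistribution (fun n ω => WithLp.toLp 2 (Z n ω)) atTop
    (id : EuclideanSpace ℝ (Fin k) → EuclideanSpace ℝ (Fin k)) (fun _ => P)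
    (multivariateGaussian 0 C)

end Samples

section Aggregation

variable {m d : ℕ} {p q : Fin m → ℕ}

/-- The weighted risk `∑ᵢ ‖tᵢ₊ + Σᵢ₊⁻¹ Σᵢ± tᵢ₋ - bᵢ‖²_{Wᵢ}`. -/
def weightedRisk (e : ∀ i, Fin (p i) ⊕ Fin (q i) ≃ Fin d) (S : Matrix (Fin d) (Fin d) ℝ)
    (W : ∀ i, Matrix (Fin (p i)) (Fin (p i)) ℝ) (b : ∀ i, Fin (p i) → ℝ) (t : Fin d → ℝ) : ℝ :=
  ∑ i, quad (W i)
    (obs (e i) t + ((blockPP (e i) S)⁻¹ * blockPM (e i) S) *ᵥ unobs (e i) t - b i)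

/-- `t` belongs to the argmin of the weighted risk. -/
def IsRiskMinimizer (e : ∀ i, Fin (p i) ⊕ Fin (q i) ≃ Fin d) (S : Matrix (Fin d) (Fin d) ℝ)
    (W : ∀ i, Matrix (Fin (p i)) (Fin (p i)) ℝ) (b : ∀ i, Fin (p i) → ℝ) (t : Fin d → ℝ) : Prop :=
  ∀ u, weightedRisk e S W b t ≤ weightedRisk e S W b u

/-- `∑ᵢ Tᵢᵀ Wᵢ Tᵢ`. -/
def information (e : ∀ i, Fin (p i) ⊕ Fin (q i) ≃ Fin d) (S : Matrix (Fin d) (Fin d) ℝ)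
    (W : ∀ i, Matrix (Fin (p i)) (Fin (p i)) ℝ) : Matrix (Fin d) (Fin d) ℝ :=
  ∑ i, (transfer (e i) S)ᵀ * W i * transfer (e i) S

/-- `Cᵍ = (∑ᵢ Tᵢᵀ Wᵢᵍ Tᵢ)⁻¹`. -/
def gaussianCov (e : ∀ i, Fin (p i) ⊕ Fin (q i) ≃ Fin d) (S : Matrix (Fin d) (Fin d) ℝ)
    (θ : Fin d → ℝ) (σ : ℝ≥0) : Matrix (Fin d) (Fin d) ℝ :=
  (information e S fun i => gaussianWeight (e i) S θ σ)⁻¹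

/-- The asymptotic covariance
`C(W) = (∑ᵢ Tᵢᵀ Wᵢ Tᵢ)⁻¹ (∑ᵢ Tᵢᵀ Wᵢ (Wᵢᵍ)⁻¹ Wᵢ Tᵢ) (∑ᵢ Tᵢᵀ Wᵢ Tᵢ)⁻¹`. -/
def aggregateCov (e : ∀ i, Fin (p i) ⊕ Fin (q i) ≃ Fin d) (S : Matrix (Fin d) (Fin d) ℝ)
    (θ : Fin d → ℝ) (σ : ℝ≥0) (W : ∀ i, Matrix (Fin (p i)) (Fin (p i)) ℝ) :
    Matrix (Fin d) (Fin d) ℝ :=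
  (information e S W)⁻¹ *
    (∑ i, (transfer (e i) S)ᵀ * W i * (gaussianWeight (e i) S θ σ)⁻¹ * W i * transfer (e i) S) *
    (information e S W)⁻¹

/-- `est` is the aggregated estimator for the (possibly data-dependent) weights `W n ω` and the
local estimates `b n ω`: a sequence of random vectors that minimizes the weighted risk whenever
the weights are positive definite.  Degenerate weights, for which the estimator is not defined,
impose no condition. -/
structure IsAggregate {Ω : Type*} [MeasurableSpace Ω] (P : Measure Ω)
    (e : ∀ i, Fin (p i) ⊕ Fin (q i) ≃ Fin d) (S : Matrix (Fin d) (Fin d) ℝ)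
    (W : ℕ → Ω → ∀ i, Matrix (Fin (p i)) (Fin (p i)) ℝ)
    (b : ℕ → Ω → ∀ i, Fin (p i) → ℝ) (est : ℕ → Ω → Fin d → ℝ) : Prop where
  aemeasurable : ∀ n, AEMeasurable (est n) P
  minimizes : ∀ n, ∀ᵐ ω ∂P, (∀ i, (W n ω i).PosDef) →
    IsRiskMinimizer e S (W n ω) (b n ω) (est n ω)

end Aggregation

end Collab

end

/-! An agent that sees only x₊ still faces a well-specified linear regression. With w =
`residualDirection`, its labels are y = ⟨x₊, Tθ⟩ + ε, where ε = ⟨x, w⟩ + ξ and Σw vanishes on the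
observed coordinates. Thus ε is uncorrelated with x₊, hence, by joint Gaussianity, independent of
it, and has variance v = ‖θ₋‖²_{Γ₋} + σ². The score εx₊ is therefore centred with covariance vΣ₊.
The local error is the inverse sample covariance applied to the average score, so its √n-limit has
covariance Σ₊⁻¹(vΣ₊)Σ₊⁻¹ = (Wᵍ)⁻¹. Since the agents are independent, one central limit theorem for
the stacked scores gives all local limits jointly, with block diagonal covariance
(`tendstoGaussian_stackedError`).

Coverage makes the maps Tᵢ jointly injective, so for positive definite weights the risk is a
strictly convex quadratic. The error of its minimizer is linear in the local errors, ∑ᵢ Bᵢ(θ̂ᵢ -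
Tᵢθ) with Bᵢ = (∑ⱼ TⱼᵀWⱼTⱼ)⁻¹TᵢᵀWᵢ (`aggregate_sub_eq`). Slutsky's theorem
(`TendstoGaussian.mulVec_of_tendsto`) yields the normal limit and admits random weights, of which
only the almost sure limit matters (`tendstoNormal_aggregate`). By the law of large numbers the
training error tends to v and the sample covariance to Σ₊, so both plug-in weights tend to Wᵍ, and
C(Wᵍ) = Cᵍ.

Optimality is the Gauss–Markov argument: ∑ᵢ BᵢTᵢ = 1 for every choice of weights, which makes C(W) -
Cᵍ a sum of squares. Collaboration does not hurt an agent because the others only add positive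
semidefinite terms to the information matrix. -/

noncomputable section

namespace Collab

/-! ### Linear algebra of a single view: transfer map, residual direction, Schur complement. -/

section OneAgentAlgebra

variable {p q d : ℕ}

/-- Sums over all features split into observed and unobserved ones. -/
lemma dotProduct_eq_obs_add_unobs (e : Fin p ⊕ Fin q ≃ Fin d) (u v : Fin d → ℝ) :
    u ⬝ᵥ v = obs e u ⬝ᵥ obs e v + unobs e u ⬝ᵥ unobs e v := by
  simp only [dotProduct, obs, unobs]
  rw [← Equiv.sum_comp e, Fintype.sum_sum_type]

lemma transfer_mulVec (e : Fin p ⊕ Fin q ≃ Fin d) (S : Matrix (Fin d) (Fin d) ℝ)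
    (t : Fin d → ℝ) :
    transfer e S *ᵥ t = obs e t + ((blockPP e S)⁻¹ * blockPM e S) *ᵥ unobs e t := by
  ext a
  simp only [transfer, mulVec, Pi.add_apply]
  rw [dotProduct_eq_obs_add_unobs e]
  congr 1
  · simp [obs, dotProduct, Matrix.one_apply]
  · simp [unobs, dotProduct]

lemma obs_mulVec (e : Fin p ⊕ Fin q ≃ Fin d) (S : Matrix (Fin d) (Fin d) ℝ)
    (t : Fin d → ℝ) :
    obs e (S *ᵥ t) = blockPP e S *ᵥ obs e t + blockPM e S *ᵥ unobs e t := by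
  ext a
  simp only [obs, mulVec, Pi.add_apply]
  rw [dotProduct_eq_obs_add_unobs e]
  rfl

lemma unobs_mulVec (e : Fin p ⊕ Fin q ≃ Fin d) (S : Matrix (Fin d) (Fin d) ℝ)
    (t : Fin d → ℝ) :
    unobs e (S *ᵥ t) = blockMP e S *ᵥ obs e t + blockMM e S *ᵥ unobs e t := by
  ext a
  simp only [unobs, mulVec, Pi.add_apply]
  rw [dotProduct_eq_obs_add_unobs e]
  rfl

lemma blockPP_posDef (e : Fin p ⊕ Fin q ≃ Fin d) {S : Matrix (Fin d) (Fin d) ℝ}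
    (hS : S.PosDef) : (blockPP e S).PosDef :=
  hS.submatrix fun _ _ h => Sum.inl_injective (e.injective h)

lemma _root_.Matrix.PosDef.isUnit_det {ι : Type*} [Fintype ι] [DecidableEq ι]
    {A : Matrix ι ι ℝ} (hA : A.PosDef) : IsUnit A.det :=
  (Matrix.isUnit_iff_isUnit_det A).1 hA.isUnit

/-- `Σ₊ T = Π₊ Σ`. -/
lemma blockPP_mulVec_transfer_mulVec (e : Fin p ⊕ Fin q ≃ Fin d)
    {S : Matrix (Fin d) (Fin d) ℝ} (hS : S.PosDef) (t : Fin d → ℝ) :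
    blockPP e S *ᵥ (transfer e S *ᵥ t) = obs e (S *ᵥ t) := by
  rw [transfer_mulVec, obs_mulVec, mulVec_add, mulVec_mulVec, ← Matrix.mul_assoc,
    mul_nonsing_inv _ (blockPP_posDef e hS).isUnit_det, Matrix.one_mul]

/-- The coefficient vector `w` of the regression residual: `⟨v, θ⟩ = ⟨v₊, T θ⟩ + ⟨v, w⟩`. -/
def residualDirection (e : Fin p ⊕ Fin q ≃ Fin d) (S : Matrix (Fin d) (Fin d) ℝ)
    (θ : Fin d → ℝ) : Fin d → ℝ :=
  fun k => Sum.elim (-(((blockPP e S)⁻¹ * blockPM e S) *ᵥ unobs e θ)) (unobs e θ) (e.symm k)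

lemma obs_residualDirection (e : Fin p ⊕ Fin q ≃ Fin d) (S : Matrix (Fin d) (Fin d) ℝ)
    (θ : Fin d → ℝ) :
    obs e (residualDirection e S θ) = -(((blockPP e S)⁻¹ * blockPM e S) *ᵥ unobs e θ) := by
  ext a; simp [obs, residualDirection]

lemma unobs_residualDirection (e : Fin p ⊕ Fin q ≃ Fin d) (S : Matrix (Fin d) (Fin d) ℝ)
    (θ : Fin d → ℝ) : unobs e (residualDirection e S θ) = unobs e θ := by
  ext a; simp [unobs, residualDirection]

/-- The residual direction subtracts on the observed side exactly what T adds there. Applied to a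
feature vector, this splits the signal into its regression on x₊ and a remainder. -/
lemma dotProduct_eq_transfer_add_residual (e : Fin p ⊕ Fin q ≃ Fin d)
    (S : Matrix (Fin d) (Fin d) ℝ) (θ v : Fin d → ℝ) :
    v ⬝ᵥ θ = obs e v ⬝ᵥ (transfer e S *ᵥ θ) + v ⬝ᵥ residualDirection e S θ := by
  rw [dotProduct_eq_obs_add_unobs e v θ, dotProduct_eq_obs_add_unobs e v (residualDirection e S θ),
    obs_residualDirection, unobs_residualDirection, transfer_mulVec, dotProduct_add,
    dotProduct_neg]
  ring

/-- The term -Σ₊Σ₊⁻¹Σ±θ₋ cancels Σ±θ₋. Probabilistically, the remainder ⟨x, w⟩ is uncorrelated with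
every observed feature. -/
lemma obs_mulVec_residualDirection (e : Fin p ⊕ Fin q ≃ Fin d)
    {S : Matrix (Fin d) (Fin d) ℝ} (hS : S.PosDef) (θ : Fin d → ℝ) :
    obs e (S *ᵥ residualDirection e S θ) = 0 := by
  rw [obs_mulVec, obs_residualDirection, unobs_residualDirection, mulVec_neg, mulVec_mulVec,
    ← Matrix.mul_assoc, mul_nonsing_inv _ (blockPP_posDef e hS).isUnit_det, Matrix.one_mul,
    neg_add_cancel]

/-- As Σw has no observed part, only ⟨w₋, (Σw)₋⟩ survives, and there w₋ = θ₋ and (Σw)₋ = Γ₋θ₋. -/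
lemma quad_residualDirection (e : Fin p ⊕ Fin q ≃ Fin d)
    {S : Matrix (Fin d) (Fin d) ℝ} (hS : S.PosDef) (θ : Fin d → ℝ) :
    quad S (residualDirection e S θ) = quad (schur e S) (unobs e θ) := by
  rw [quad, quad, dotProduct_eq_obs_add_unobs e, obs_mulVec_residualDirection e hS, dotProduct_zero,
    zero_add, unobs_residualDirection, unobs_mulVec, obs_residualDirection,
    unobs_residualDirection, schur, sub_mulVec, mulVec_neg, mulVec_mulVec, Matrix.mul_assoc]
  congr 1
  abel

lemma gaussianWeight_posDef (e : Fin p ⊕ Fin q ≃ Fin d) {S : Matrix (Fin d) (Fin d) ℝ}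
    (hS : S.PosDef) {θ : Fin d → ℝ} {σ : ℝ≥0} (hpos : 0 < residualVariance e S θ σ) :
    (gaussianWeight e S θ σ).PosDef :=
  (blockPP_posDef e hS).smul (inv_pos.2 hpos)

lemma gaussianWeight_inv (e : Fin p ⊕ Fin q ≃ Fin d) {S : Matrix (Fin d) (Fin d) ℝ}
    (hS : S.PosDef) {θ : Fin d → ℝ} {σ : ℝ≥0} (hpos : 0 < residualVariance e S θ σ) :
    (gaussianWeight e S θ σ)⁻¹ = residualVariance e S θ σ • (blockPP e S)⁻¹ := by
  refine inv_eq_right_inv ?_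
  rw [gaussianWeight, smul_mul_smul_comm, inv_mul_cancel₀ hpos.ne',
    mul_nonsing_inv _ (blockPP_posDef e hS).isUnit_det, one_smul]

end OneAgentAlgebra

/-! ### Weighted aggregation: the minimizer, its covariance and its optimality. -/

section AggregationAlgebra

variable {m d : ℕ} {p q : Fin m → ℕ}

lemma quad_mulVec {k l : ℕ} (A : Matrix (Fin k) (Fin l) ℝ) (W : Matrix (Fin k) (Fin k) ℝ)
    (v : Fin l → ℝ) : quad W (A *ᵥ v) = v ⬝ᵥ ((Aᵀ * W * A) *ᵥ v) := by
  rw [quad, ← mulVec_mulVec, ← mulVec_mulVec, dotProduct_mulVec v Aᵀ, vecMul_transpose]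

lemma quad_information (e : ∀ i, Fin (p i) ⊕ Fin (q i) ≃ Fin d)
    (S : Matrix (Fin d) (Fin d) ℝ) (W : ∀ i, Matrix (Fin (p i)) (Fin (p i)) ℝ) (v : Fin d → ℝ) :
    quad (information e S W) v = ∑ i, quad (W i) (transfer (e i) S *ᵥ v) := by
  simp_rw [quad_mulVec]
  rw [quad, information, sum_mulVec, dotProduct_sum]

lemma quad_nonneg {k : ℕ} {A : Matrix (Fin k) (Fin k) ℝ} (hA : A.PosSemidef) (v : Fin k → ℝ) :
    0 ≤ quad A v := by
  simpa [quad] using hA.dotProduct_mulVec_nonneg v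

lemma quad_pos {k : ℕ} {A : Matrix (Fin k) (Fin k) ℝ} (hA : A.PosDef) {v : Fin k → ℝ}
    (hv : v ≠ 0) : 0 < quad A v := by
  simpa [quad] using hA.dotProduct_mulVec_pos hv

lemma information_isHermitian (e : ∀ i, Fin (p i) ⊕ Fin (q i) ≃ Fin d)
    (S : Matrix (Fin d) (Fin d) ℝ) {W : ∀ i, Matrix (Fin (p i)) (Fin (p i)) ℝ}
    (hW : ∀ i, (W i).IsHermitian) : (information e S W).IsHermitian := by
  have this (i) : (W i)ᵀ = W i := by simpa using (hW i).eq
  simp [IsHermitian, information, transpose_sum, Matrix.mul_assoc, this]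

/-- If every feature is observed, the maps `Tᵢ` are jointly injective. -/
lemma eq_zero_of_transfer_mulVec_eq_zero {e : ∀ i, Fin (p i) ⊕ Fin (q i) ≃ Fin d}
    (hcover : ∀ k, ∃ i a, e i (Sum.inl a) = k) {S : Matrix (Fin d) (Fin d) ℝ} (hS : S.PosDef)
    {v : Fin d → ℝ} (hv : ∀ i, transfer (e i) S *ᵥ v = 0) : v = 0 := by
  -- Each coordinate k is some agent's a-th observed one, and there (Σv)ₖ = (Σᵢ₊Tᵢv)ₐ = 0.
  have h0 : S *ᵥ v = 0 := by
    ext k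
    obtain ⟨i, a, rfl⟩ := hcover k
    have := blockPP_mulVec_transfer_mulVec (e i) hS v
    rw [hv i, mulVec_zero] at this
    exact (congrFun this a).symm
  by_contra hne
  have := quad_pos hS hne
  simp [quad, h0] at this

lemma information_posDef {e : ∀ i, Fin (p i) ⊕ Fin (q i) ≃ Fin d}
    (hcover : ∀ k, ∃ i a, e i (Sum.inl a) = k) {S : Matrix (Fin d) (Fin d) ℝ} (hS : S.PosDef)
    {W : ∀ i, Matrix (Fin (p i)) (Fin (p i)) ℝ} (hW : ∀ i, (W i).PosDef) :
    (information e S W).PosDef := by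
  refine .of_dotProduct_mulVec_pos (information_isHermitian e S fun i => (hW i).isHermitian) ?_
  intro v hv
  change 0 < quad (information e S W) v
  rw [quad_information]
  obtain ⟨i, hi⟩ : ∃ i, transfer (e i) S *ᵥ v ≠ 0 := by
    by_contra! h
    exact hv (eq_zero_of_transfer_mulVec_eq_zero hcover hS h)
  exact Finset.sum_pos' (fun j _ => quad_nonneg (hW j).posSemidef _)
    ⟨i, Finset.mem_univ i, quad_pos (hW i) hi⟩

lemma weightedRisk_eq (e : ∀ i, Fin (p i) ⊕ Fin (q i) ≃ Fin d) (S : Matrix (Fin d) (Fin d) ℝ)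
    (W : ∀ i, Matrix (Fin (p i)) (Fin (p i)) ℝ) (b : ∀ i, Fin (p i) → ℝ) (t : Fin d → ℝ) :
    weightedRisk e S W b t = ∑ i, quad (W i) (transfer (e i) S *ᵥ t - b i) := by
  simp only [weightedRisk, transfer_mulVec]

lemma quad_add {k : ℕ} {A : Matrix (Fin k) (Fin k) ℝ} (hA : A.IsHermitian) (u v : Fin k → ℝ) :
    quad A (u + v) = quad A u + 2 * (u ⬝ᵥ (A *ᵥ v)) + quad A v := by
  have hAt : Aᵀ = A := by simpa using hA.eq
  have : v ⬝ᵥ (A *ᵥ u) = u ⬝ᵥ (A *ᵥ v) := by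
    rw [dotProduct_mulVec, dotProduct_comm, ← mulVec_transpose, hAt]
  simp only [quad, mulVec_add, dotProduct_add, add_dotProduct, this]
  ring

/-- The closed form of the weighted least squares solution. -/
def aggregate (e : ∀ i, Fin (p i) ⊕ Fin (q i) ≃ Fin d) (S : Matrix (Fin d) (Fin d) ℝ)
    (W : ∀ i, Matrix (Fin (p i)) (Fin (p i)) ℝ) (b : ∀ i, Fin (p i) → ℝ) : Fin d → ℝ :=
  (information e S W)⁻¹ *ᵥ ∑ i, ((transfer (e i) S)ᵀ * W i) *ᵥ b i

/-- Completing the square around the solution of the normal equations, which kill the cross term.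
Existence and uniqueness of the minimizer both follow. -/
lemma weightedRisk_eq_add {e : ∀ i, Fin (p i) ⊕ Fin (q i) ≃ Fin d}
    (hcover : ∀ k, ∃ i a, e i (Sum.inl a) = k) {S : Matrix (Fin d) (Fin d) ℝ} (hS : S.PosDef)
    {W : ∀ i, Matrix (Fin (p i)) (Fin (p i)) ℝ} (hW : ∀ i, (W i).PosDef)
    (b : ∀ i, Fin (p i) → ℝ) (t : Fin d → ℝ) :
    weightedRisk e S W b t = weightedRisk e S W b (aggregate e S W b) +
      quad (information e S W) (t - aggregate e S W b) := by
  set s := aggregate e S W b with hs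
  have hnormal : ∑ i, ((transfer (e i) S)ᵀ * W i) *ᵥ (transfer (e i) S *ᵥ s - b i) = 0 := by
    simp_rw [mulVec_sub, mulVec_mulVec]
    rw [Finset.sum_sub_distrib, ← sum_mulVec, ← information, hs, aggregate, mulVec_mulVec,
      mul_nonsing_inv _ (information_posDef hcover hS hW).isUnit_det, one_mulVec, sub_self]
  rw [weightedRisk_eq, weightedRisk_eq, quad_information]
  have this (i) : quad (W i) (transfer (e i) S *ᵥ t - b i) =
      quad (W i) (transfer (e i) S *ᵥ s - b i) + quad (W i) (transfer (e i) S *ᵥ (t - s)) +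
      2 * ((t - s) ⬝ᵥ (((transfer (e i) S)ᵀ * W i) *ᵥ (transfer (e i) S *ᵥ s - b i))) := by
    have h1 : transfer (e i) S *ᵥ t - b i =
        transfer (e i) S *ᵥ (t - s) + (transfer (e i) S *ᵥ s - b i) := by
      rw [mulVec_sub]; abel
    rw [h1, quad_add (hW i).isHermitian, ← mulVec_mulVec _ _ (W i), dotProduct_mulVec (t - s),
      vecMul_transpose]
    ring
  simp_rw [this]
  rw [Finset.sum_add_distrib, Finset.sum_add_distrib, ← Finset.mul_sum, ← dotProduct_sum, hnormal]
  simp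

lemma isRiskMinimizer_iff {e : ∀ i, Fin (p i) ⊕ Fin (q i) ≃ Fin d}
    (hcover : ∀ k, ∃ i a, e i (Sum.inl a) = k) {S : Matrix (Fin d) (Fin d) ℝ} (hS : S.PosDef)
    {W : ∀ i, Matrix (Fin (p i)) (Fin (p i)) ℝ} (hW : ∀ i, (W i).PosDef)
    (b : ∀ i, Fin (p i) → ℝ) (t : Fin d → ℝ) :
    IsRiskMinimizer e S W b t ↔ t = aggregate e S W b := by
  have hH := information_posDef hcover hS hW
  constructor
  · intro h
    by_contra hne
    have h1 := h (aggregate e S W b)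
    have h2 := weightedRisk_eq_add hcover hS hW b t
    have h3 := quad_pos hH (sub_ne_zero.2 hne)
    linarith
  · rintro rfl u
    rw [weightedRisk_eq_add hcover hS hW b u]
    linarith [quad_nonneg hH.posSemidef (u - aggregate e S W b)]

/-- Aggregation is linear in the local estimates and returns θ when fed the exact values Tᵢθ. The
error is thus the same linear map applied to the local errors. -/
lemma aggregate_sub_eq {e : ∀ i, Fin (p i) ⊕ Fin (q i) ≃ Fin d}
    (hcover : ∀ k, ∃ i a, e i (Sum.inl a) = k) {S : Matrix (Fin d) (Fin d) ℝ} (hS : S.PosDef)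
    {W : ∀ i, Matrix (Fin (p i)) (Fin (p i)) ℝ} (hW : ∀ i, (W i).PosDef)
    (b : ∀ i, Fin (p i) → ℝ) (θ : Fin d → ℝ) :
    aggregate e S W b - θ =
      ∑ i, ((information e S W)⁻¹ * ((transfer (e i) S)ᵀ * W i)) *ᵥ
        (b i - transfer (e i) S *ᵥ θ) := by
  simp_rw [← mulVec_mulVec _ (information e S W)⁻¹]
  rw [← mulVec_sum]
  simp_rw [mulVec_sub, mulVec_mulVec _ _ (transfer _ _)]
  rw [Finset.sum_sub_distrib, mulVec_sub, ← aggregate, ← sum_mulVec, ← information, mulVec_mulVec,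
    nonsing_inv_mul _ (information_posDef hcover hS hW).isUnit_det, one_mulVec]

/-- `C(W)` as a sum over agents of linear images of the local covariances. -/
lemma aggregateCov_eq_sum (e : ∀ i, Fin (p i) ⊕ Fin (q i) ≃ Fin d)
    (S : Matrix (Fin d) (Fin d) ℝ) (θ : Fin d → ℝ) (σ : ℝ≥0)
    {W : ∀ i, Matrix (Fin (p i)) (Fin (p i)) ℝ} (hW : ∀ i, (W i).IsHermitian) :
    aggregateCov e S θ σ W =
      ∑ i, ((information e S W)⁻¹ * ((transfer (e i) S)ᵀ * W i)) *
        (gaussianWeight (e i) S θ σ)⁻¹ *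
        ((information e S W)⁻¹ * ((transfer (e i) S)ᵀ * W i))ᵀ := by
  have hWt (i) : (W i)ᵀ = W i := by simpa using (hW i).eq
  have hH : (information e S W)ᵀ = information e S W := by
    simpa using (information_isHermitian e S hW).eq
  rw [aggregateCov, Finset.mul_sum, Finset.sum_mul]
  refine Finset.sum_congr rfl fun i _ => ?_
  simp only [transpose_mul, transpose_transpose, transpose_nonsing_inv, hWt, hH, Matrix.mul_assoc]

lemma aggregateCov_gaussianWeight {e : ∀ i, Fin (p i) ⊕ Fin (q i) ≃ Fin d}
    (hcover : ∀ k, ∃ i a, e i (Sum.inl a) = k) {S : Matrix (Fin d) (Fin d) ℝ} (hS : S.PosDef)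
    {θ : Fin d → ℝ} {σ : ℝ≥0} (hpos : ∀ i, 0 < residualVariance (e i) S θ σ) :
    aggregateCov e S θ σ (fun i => gaussianWeight (e i) S θ σ) = gaussianCov e S θ σ := by
  have hW (i) := gaussianWeight_posDef (e i) hS (hpos i)
  rw [aggregateCov, gaussianCov]
  have : ∑ i, (transfer (e i) S)ᵀ * gaussianWeight (e i) S θ σ * (gaussianWeight (e i) S θ σ)⁻¹ *
      gaussianWeight (e i) S θ σ * transfer (e i) S =
      information e S (fun i => gaussianWeight (e i) S θ σ) := by
    rw [information]
    refine Finset.sum_congr rfl fun i _ => ?_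
    rw [Matrix.mul_assoc _ (gaussianWeight (e i) S θ σ) (gaussianWeight (e i) S θ σ)⁻¹,
      mul_nonsing_inv _ (hW i).isUnit_det, Matrix.mul_one]
  rw [this, nonsing_inv_mul _ (information_posDef hcover hS hW).isUnit_det, Matrix.one_mul]

lemma gaussianCov_posDef {e : ∀ i, Fin (p i) ⊕ Fin (q i) ≃ Fin d}
    (hcover : ∀ k, ∃ i a, e i (Sum.inl a) = k) {S : Matrix (Fin d) (Fin d) ℝ} (hS : S.PosDef)
    {θ : Fin d → ℝ} {σ : ℝ≥0} (hpos : ∀ i, 0 < residualVariance (e i) S θ σ) :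
    (gaussianCov e S θ σ).PosDef :=
  (information_posDef hcover hS fun i => gaussianWeight_posDef (e i) hS (hpos i)).inv

/-- The Gauss–Markov inequality `C(W) ⪰ Cᵍ`. -/
lemma aggregateCov_sub_gaussianCov_posSemidef {e : ∀ i, Fin (p i) ⊕ Fin (q i) ≃ Fin d}
    (hcover : ∀ k, ∃ i a, e i (Sum.inl a) = k) {S : Matrix (Fin d) (Fin d) ℝ} (hS : S.PosDef)
    {θ : Fin d → ℝ} {σ : ℝ≥0} (hpos : ∀ i, 0 < residualVariance (e i) S θ σ)
    {W : ∀ i, Matrix (Fin (p i)) (Fin (p i)) ℝ} (hW : ∀ i, (W i).PosDef) :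
    (aggregateCov e S θ σ W - gaussianCov e S θ σ).PosSemidef := by
  have hG (i) := gaussianWeight_posDef (e i) hS (hpos i)
  obtain ⟨B, hB⟩ : ∃ B : ∀ i, Matrix (Fin d) (Fin (p i)) ℝ,
      B = fun i => (information e S W)⁻¹ * ((transfer (e i) S)ᵀ * W i) := ⟨_, rfl⟩
  set G : ∀ i, Matrix (Fin (p i)) (Fin (p i)) ℝ := fun i => gaussianWeight (e i) S θ σ with hGdef
  set C := gaussianCov e S θ σ with hC
  have hGt (i) : (G i)ᵀ = G i := by simpa using (hG i).isHermitian.eq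
  have hCt : Cᵀ = C := by simpa using (gaussianCov_posDef hcover hS hpos).isHermitian.eq
  -- Unbiasedness of the linear estimator with coefficients Bᵢ, the Gauss–Markov constraint.
  have hBT : ∑ i, B i * transfer (e i) S = 1 := by
    simp_rw [hB, Matrix.mul_assoc (information e S W)⁻¹]
    rw [← Finset.mul_sum, ← information,
      nonsing_inv_mul _ (information_posDef hcover hS hW).isUnit_det]
  have hBTt : ∑ i, (transfer (e i) S)ᵀ * (B i)ᵀ = 1 := by
    rw [← Matrix.transpose_one, ← hBT, transpose_sum]
    simp_rw [transpose_mul]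
  have hCH : C * ∑ i, (transfer (e i) S)ᵀ * G i * transfer (e i) S = 1 :=
    nonsing_inv_mul _ (information_posDef hcover hS hG).isUnit_det
  -- The optimal coefficients are CTᵢᵀGᵢ. After summation the constraint turns both cross terms into
  -- -C, and the last square contributes +C.
  have key : aggregateCov e S θ σ W - C =
      ∑ i, (B i - C * (transfer (e i) S)ᵀ * G i) * (G i)⁻¹ *
        (B i - C * (transfer (e i) S)ᵀ * G i)ᴴ := by
    have expand (i) : (B i - C * (transfer (e i) S)ᵀ * G i) * (G i)⁻¹ *
        (B i - C * (transfer (e i) S)ᵀ * G i)ᴴ =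
        B i * (G i)⁻¹ * (B i)ᵀ - (B i * transfer (e i) S) * C
          - C * ((transfer (e i) S)ᵀ * (B i)ᵀ)
          + C * ((transfer (e i) S)ᵀ * G i * transfer (e i) S) * C := by
      have h1 : G i * (G i)⁻¹ = 1 := mul_nonsing_inv _ (hG i).isUnit_det
      have h2 : (G i)⁻¹ * G i = 1 := nonsing_inv_mul _ (hG i).isUnit_det
      rw [conjTranspose_eq_transpose_of_trivial, transpose_sub, transpose_mul, transpose_mul,
        transpose_transpose, hGt, hCt, Matrix.sub_mul, Matrix.sub_mul, Matrix.mul_sub,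
        Matrix.mul_sub, Matrix.mul_assoc (C * (transfer (e i) S)ᵀ) (G i), h1, Matrix.mul_one,
        Matrix.mul_assoc (B i) (G i)⁻¹ (G i * _), ← Matrix.mul_assoc (G i)⁻¹ (G i), h2,
        Matrix.one_mul]
      simp only [Matrix.mul_assoc]
      abel
    simp_rw [expand]
    rw [Finset.sum_add_distrib, Finset.sum_sub_distrib, Finset.sum_sub_distrib,
      ← Finset.sum_mul, ← Finset.sum_mul, ← Finset.mul_sum, ← Finset.mul_sum, hBT, hBTt, hCH,
      aggregateCov_eq_sum e S θ σ fun i => (hW i).isHermitian, hB]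
    simp [hGdef]
  rw [key]
  exact posSemidef_sum _ fun i _ => (hG i).inv.posSemidef.mul_mul_conjTranspose_same _

/-- The total information exceeds agent i's own share TᵀGT by the shares of the other agents, which
are positive semidefinite. The difference of covariances is then a sum of two congruences. -/
lemma gaussianWeight_inv_sub_posSemidef {e : ∀ i, Fin (p i) ⊕ Fin (q i) ≃ Fin d}
    (hcover : ∀ k, ∃ i a, e i (Sum.inl a) = k) {S : Matrix (Fin d) (Fin d) ℝ} (hS : S.PosDef)
    {θ : Fin d → ℝ} {σ : ℝ≥0} (hpos : ∀ i, 0 < residualVariance (e i) S θ σ) (i : Fin m) :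
    ((gaussianWeight (e i) S θ σ)⁻¹ -
      transfer (e i) S * gaussianCov e S θ σ * (transfer (e i) S)ᵀ).PosSemidef := by
  have hG (i) := gaussianWeight_posDef (e i) hS (hpos i)
  set G : ∀ i, Matrix (Fin (p i)) (Fin (p i)) ℝ := fun i => gaussianWeight (e i) S θ σ with hGdef
  set C := gaussianCov e S θ σ with hC
  set T := transfer (e i) S with hT
  have hGt : (G i)ᵀ = G i := by simpa using (hG i).isHermitian.eq
  have hCt : Cᵀ = C := by simpa using (gaussianCov_posDef hcover hS hpos).isHermitian.eq
  have hrest : information e S G - Tᵀ * G i * T =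
      ∑ j ∈ Finset.univ.erase i, (transfer (e j) S)ᵀ * G j * transfer (e j) S := by
    rw [information, ← Finset.add_sum_erase _ _ (Finset.mem_univ i)]
    abel
  have hrest_psd : (information e S G - Tᵀ * G i * T).PosSemidef := by
    rw [hrest]
    refine posSemidef_sum _ fun j _ => ?_
    simpa using (hG j).posSemidef.conjTranspose_mul_mul_same (transfer (e j) S)
  have hCHC : C * information e S G * C = C := by
    rw [hC, gaussianCov, nonsing_inv_mul _ (information_posDef hcover hS hG).isUnit_det,
      Matrix.one_mul]
  have h1 : G i * (G i)⁻¹ = 1 := mul_nonsing_inv _ (hG i).isUnit_det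
  have h2 : (G i)⁻¹ * G i = 1 := nonsing_inv_mul _ (hG i).isUnit_det
  -- The first square is G⁻¹ - 2TCTᵀ + TCTᵀGTCTᵀ. The second term is TCTᵀ - TCTᵀGTCTᵀ, because C
  -- inverts the information matrix.
  have key : (G i)⁻¹ - T * C * Tᵀ =
      (1 - T * C * Tᵀ * G i) * (G i)⁻¹ * (1 - T * C * Tᵀ * G i)ᴴ +
        (T * C) * (information e S G - Tᵀ * G i * T) * (T * C)ᴴ := by
    have e1 : (1 - T * C * Tᵀ * G i) * (G i)⁻¹ * (1 - T * C * Tᵀ * G i)ᴴ =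
        (G i)⁻¹ - T * C * Tᵀ - T * C * Tᵀ + T * C * Tᵀ * G i * T * C * Tᵀ := by
      rw [conjTranspose_eq_transpose_of_trivial, transpose_sub, transpose_mul, transpose_mul,
        transpose_mul, transpose_transpose, hGt, hCt, transpose_one, Matrix.sub_mul,
        Matrix.one_mul, Matrix.mul_assoc _ (G i) (G i)⁻¹, h1, Matrix.mul_one, Matrix.mul_sub,
        Matrix.mul_one, Matrix.sub_mul, ← Matrix.mul_assoc (G i)⁻¹, h2, Matrix.one_mul]
      simp only [Matrix.mul_assoc]
      abel
    have e2 : (T * C) * (information e S G - Tᵀ * G i * T) * (T * C)ᴴ =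
        T * C * Tᵀ - T * C * Tᵀ * G i * T * C * Tᵀ := by
      rw [conjTranspose_eq_transpose_of_trivial, transpose_mul, hCt, Matrix.mul_sub,
        Matrix.sub_mul]
      congr 1
      · conv_rhs => rw [← hCHC]
        simp only [Matrix.mul_assoc]
      · simp only [Matrix.mul_assoc]
    rw [e1, e2]
    abel
  rw [key]
  exact ((hG i).inv.posSemidef.mul_mul_conjTranspose_same _).add
    (hrest_psd.mul_mul_conjTranspose_same _)

end AggregationAlgebra

/-! ### Continuity and measurability of matrix inversion. -/

section MatrixInverse

variable {ι : Type*} [Fintype ι] [DecidableEq ι]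

/-- Valid for singular matrices too, as both inverses then default to 0. This is why inversion is
Borel on the whole space. -/
lemma _root_.Matrix.inv_eq_inv_det_smul_adjugate (A : Matrix ι ι ℝ) :
    A⁻¹ = (A.det)⁻¹ • A.adjugate := by
  rw [Matrix.inv_def, Ring.inverse_eq_inv']

/-- Matrix inversion is continuous at invertible matrices. -/
lemma tendsto_matrix_inv {α : Type*} {l : Filter α} {A : α → Matrix ι ι ℝ} {B : Matrix ι ι ℝ}
    (hB : IsUnit B.det) (h : Tendsto A l (𝓝 B)) : Tendsto (fun x => (A x)⁻¹) l (𝓝 B⁻¹) := by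
  simp_rw [Matrix.inv_eq_inv_det_smul_adjugate]
  exact (((Continuous.matrix_det continuous_id).tendsto B).comp h |>.inv₀ hB.ne_zero).smul
    (((Continuous.matrix_adjugate continuous_id).tendsto B).comp h)

/-- Matrix inversion is a Borel map. -/
lemma measurable_matrix_inv :
    Measurable (fun A : ι → ι → ℝ => fun i j => (Matrix.of A)⁻¹ i j) := by
  have h (A : ι → ι → ℝ) : (fun i j => (Matrix.of A)⁻¹ i j) =
      ((Matrix.of A).det)⁻¹ • fun i j => (Matrix.of A).adjugate i j := by
    funext i j
    rw [Matrix.inv_eq_inv_det_smul_adjugate]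
    rfl
  simp_rw [h]
  have hdet : Continuous fun A : ι → ι → ℝ => (Matrix.of A).det :=
    Continuous.matrix_det continuous_id
  have hadj : Continuous fun (A : ι → ι → ℝ) (i j : ι) => (Matrix.of A).adjugate i j :=
    Continuous.matrix_adjugate continuous_id
  exact hdet.measurable.inv.smul hadj.measurable

end MatrixInverse

/-! ### Probabilistic tools: grouping of independent families, Slutsky's theorem, the multivariate
central limit theorem. -/

section Probability

variable {Ω : Type*} [MeasurableSpace Ω] {P : Measure Ω}

/-- Events that almost surely hold eventually have probability tending to one. -/
lemma tendsto_measure_one_of_ae_eventually [IsProbabilityMeasure P] {A : ℕ → Set Ω}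
    (h : ∀ᵐ ω ∂P, ∀ᶠ n in atTop, ω ∈ A n) : Tendsto (fun n => P (A n)) atTop (𝓝 1) := by
  -- These sets increase to an almost sure event and B N ⊆ A N, so continuity from below suffices.
  -- Monotonicity makes measurability of the sets unnecessary.
  set B : ℕ → Set Ω := fun N => {ω | ∀ n, N ≤ n → ω ∈ A n} with hB
  have hmono : Monotone B := fun N N' hNN' ω hω n hn => hω n (hNN'.trans hn)
  have hunion : P (⋃ N, B N) = 1 := by
    rw [← measure_univ (μ := P)]
    refine measure_congr ?_
    filter_upwards [h] with ω hω
    obtain ⟨N, hN⟩ := eventually_atTop.1 hω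
    exact propext ⟨fun _ => trivial, fun _ => Set.mem_iUnion.2 ⟨N, hN⟩⟩
  have hlim := tendsto_measure_iUnion_atTop (μ := P) hmono
  rw [hunion] at hlim
  exact tendsto_of_tendsto_of_tendsto_of_le_of_le hlim tendsto_const_nhds
    (fun n => measure_mono fun ω hω => hω n le_rfl) fun n => prob_le_one

/-- Grouping independent variables indexed by a product along the first index. -/
lemma iIndepFun_curry [IsProbabilityMeasure P] {ι κ 𝓧 : Type*} [Countable ι] [Countable κ]
    [MeasurableSpace 𝓧] {X : ι → κ → Ω → 𝓧} (hX : ∀ i j, AEMeasurable (X i j) P)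
    (h : iIndepFun (fun (s : ι × κ) => X s.1 s.2) P) :
    iIndepFun (fun i ω j => X i j ω) P := by
  have this (i j) : IsProbabilityMeasure (P.map (X i j)) :=
    Measure.isProbabilityMeasure_map (hX i j)
  have hrow (i) : iIndepFun (X i) P := h.precomp (g := fun j => (i, j)) fun _ _ => by simp
  have hlaw := h.map_fun_eq_infinitePi_map₀' fun s : ι × κ => hX s.1 s.2
  -- Independence is tested on joint laws: currying a product measure over ι × κ gives a product
  -- over ι of the row laws.
  rw [iIndepFun_iff_map_fun_eq_infinitePi_map₀' fun i => aemeasurable_pi_lambda _ (hX i)]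
  have hcomp : (fun ω i j => X i j ω) =
      MeasurableEquiv.curry ι κ 𝓧 ∘ fun ω (s : ι × κ) => X s.1 s.2 ω := rfl
  rw [hcomp, ← AEMeasurable.map_map_of_aemeasurable
    (MeasurableEquiv.curry ι κ 𝓧).measurable.aemeasurable
    (aemeasurable_pi_lambda _ fun s => hX s.1 s.2), hlaw,
    Measure.infinitePi_map_curry (fun i j => P.map (X i j))]
  congr 1
  funext i
  exact ((hrow i).map_fun_eq_infinitePi_map₀' (hX i)).symm

section TendstoGaussian

variable {ι κ : Type*} [Fintype ι] [DecidableEq ι] [Fintype κ] [DecidableEq κ]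

/-- Convergence in distribution to `N(0, C)` for vectors with an arbitrary finite index set. -/
def TendstoGaussian (P : Measure Ω) [IsProbabilityMeasure P]
    (Z : ℕ → Ω → ι → ℝ) (C : Matrix ι ι ℝ) : Prop :=
  TendstoInDistribution (fun n ω => WithLp.toLp 2 (Z n ω)) atTop
    (id : EuclideanSpace ℝ ι → EuclideanSpace ℝ ι) (fun _ => P) (multivariateGaussian 0 C)

/-- A linear image of a centred Gaussian vector. -/
lemma map_mulVec_multivariateGaussian {C : Matrix ι ι ℝ} (hC : C.PosSemidef) (M : Matrix κ ι ℝ) :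
    (multivariateGaussian 0 C).map
      (fun z : EuclideanSpace ℝ ι => (WithLp.toLp 2 (M *ᵥ z.ofLp) : EuclideanSpace ℝ κ)) =
      multivariateGaussian 0 (M * C * Mᵀ) := by
  have hcont : Continuous
      (fun z : EuclideanSpace ℝ ι => (WithLp.toLp 2 (M *ᵥ z.ofLp) : EuclideanSpace ℝ κ)) := by
    fun_prop
  have : IsProbabilityMeasure ((multivariateGaussian 0 C).map
      (fun z : EuclideanSpace ℝ ι => (WithLp.toLp 2 (M *ᵥ z.ofLp) : EuclideanSpace ℝ κ))) :=
    Measure.isProbabilityMeasure_map hcont.measurable.aemeasurable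
  have hC' : (M * C * Mᵀ).PosSemidef := by simpa using hC.mul_mul_conjTranspose_same M
  refine Measure.ext_of_charFun ?_
  funext t
  rw [charFun_multivariateGaussian hC', charFun_apply,
    integral_map hcont.measurable.aemeasurable (by fun_prop)]
  have h (z : EuclideanSpace ℝ ι) :
      inner ℝ (WithLp.toLp 2 (M *ᵥ z.ofLp) : EuclideanSpace ℝ κ) t =
        inner ℝ z (WithLp.toLp 2 (Mᵀ *ᵥ t.ofLp)) := by
    simp only [EuclideanSpace.inner_eq_star_dotProduct, star_trivial]
    rw [dotProduct_mulVec, ← mulVec_transpose, dotProduct_comm, dotProduct_comm z.ofLp]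
  simp_rw [h]
  rw [← charFun_apply, charFun_multivariateGaussian hC]
  congr 3
  · simp
  · simp only [mulVec_mulVec, Matrix.mul_assoc]
    rw [← mulVec_mulVec _ M, dotProduct_mulVec t.ofLp M, ← mulVec_transpose]

/-- Slutsky's theorem: almost sure convergence of the matrices to a constant gives convergence in
measure, and the product is continuous. Asking for Y = AZ only eventually discards the sample sizes
at which a sample covariance is singular or a weight degenerate. -/
lemma TendstoGaussian.mulVec_of_tendsto [IsProbabilityMeasure P] {Z : ℕ → Ω → ι → ℝ}
    {C : Matrix ι ι ℝ} (hC : C.PosSemidef) (hZ : TendstoGaussian P Z C)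
    {A : ℕ → Ω → Matrix κ ι ℝ} {M : Matrix κ ι ℝ}
    (hA : ∀ n k s, AEMeasurable (fun ω => A n ω k s) P)
    (hAM : ∀ᵐ ω ∂P, Tendsto (fun n => A n ω) atTop (𝓝 M))
    {Y : ℕ → Ω → κ → ℝ} (hY : ∀ n, AEMeasurable (Y n) P)
    (hYA : ∀ᵐ ω ∂P, ∀ᶠ n in atTop, Y n ω = A n ω *ᵥ Z n ω) :
    TendstoGaussian P Y (M * C * Mᵀ) := by
  have hZm (n) : AEMeasurable (fun ω => WithLp.toLp 2 (Z n ω)) P := hZ.forall_aemeasurable n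
  have hA' (n) : AEMeasurable (fun ω k s => A n ω k s) P :=
    aemeasurable_pi_lambda _ fun k => aemeasurable_pi_lambda _ fun s => hA n k s
  have hAM' : ∀ᵐ ω ∂P, Tendsto (fun n k s => A n ω k s) atTop (𝓝 fun k s => M k s) := hAM
  have hg : Continuous (fun x : EuclideanSpace ℝ ι × (κ → ι → ℝ) =>
      (WithLp.toLp 2 (Matrix.of x.2 *ᵥ x.1.ofLp) : EuclideanSpace ℝ κ)) := by
    have : Continuous fun x : EuclideanSpace ℝ ι × (κ → ι → ℝ) => Matrix.of x.2 *ᵥ x.1.ofLp :=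
      Continuous.matrix_mulVec continuous_snd (by fun_prop)
    fun_prop
  have h1 := TendstoInDistribution.continuous_comp_prodMk_of_tendstoInMeasure_const hg hZ
    (tendstoInMeasure_of_tendsto_ae (fun n => (hA' n).aestronglyMeasurable) hAM') hA'
  have hYm (n) : AEMeasurable (fun ω => WithLp.toLp 2 (Y n ω)) P :=
    (WithLp.measurable_toLp 2 _).comp_aemeasurable (hY n)
  have h2 := tendstoInDistribution_of_tendstoInMeasure_sub
    (fun n ω => (WithLp.toLp 2 (Y n ω) : EuclideanSpace ℝ κ)) _ h1 ?_ hYm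
  · refine ⟨hYm, aemeasurable_id, ?_⟩
    have h3 := h2.tendsto
    convert h3 using 3
    simp only [Measure.map_id, id]
    congr 2
    exact (map_mulVec_multivariateGaussian hC M).symm
  · refine tendstoInMeasure_of_tendsto_ae (fun n => ?_) ?_
    · exact ((hYm n).sub (hg.measurable.comp_aemeasurable
        ((hZm n).prodMk (hA' n)))).aestronglyMeasurable
    · filter_upwards [hYA] with ω hω
      refine tendsto_const_nhds.congr' ?_
      filter_upwards [hω] with n hn
      simp only [Pi.sub_apply, Pi.zero_apply, hn]
      exact (sub_self _).symm

lemma TendstoGaussian.mulVec [IsProbabilityMeasure P] {Z : ℕ → Ω → ι → ℝ}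
    {C : Matrix ι ι ℝ} (hC : C.PosSemidef) (hZ : TendstoGaussian P Z C) (M : Matrix κ ι ℝ) :
    TendstoGaussian P (fun n ω => M *ᵥ Z n ω) (M * C * Mᵀ) := by
  refine hZ.mulVec_of_tendsto hC (A := fun _ _ => M) (fun _ _ _ => aemeasurable_const)
    (ae_of_all _ fun _ => tendsto_const_nhds) (fun n => ?_)
    (ae_of_all _ fun _ => Eventually.of_forall fun _ => rfl)
  have h : Continuous fun z : EuclideanSpace ℝ ι => M *ᵥ z.ofLp := by fun_prop
  exact h.measurable.comp_aemeasurable (hZ.forall_aemeasurable n)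

/-- The multivariate central limit theorem for centred square integrable vectors. -/
lemma tendstoGaussian_inv_sqrt_smul_sum [IsProbabilityMeasure P] {V : ℕ → Ω → ι → ℝ}
    {C : Matrix ι ι ℝ} (hC : C.PosSemidef) (hindep : iIndepFun V P)
    (hident : ∀ j, IdentDistrib (V j) (V 0) P P) (hL2 : ∀ s, MemLp (fun ω => V 0 ω s) 2 P)
    (hmean : ∀ s, ∫ ω, V 0 ω s ∂P = 0)
    (hcov : ∀ t : ι → ℝ, ∫ ω, (t ⬝ᵥ V 0 ω) ^ 2 ∂P = t ⬝ᵥ (C *ᵥ t)) :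
    TendstoGaussian P (fun n ω => (√(n : ℝ))⁻¹ • ∑ j ∈ Finset.range n, V j ω) C := by
  have hVm (j) : AEMeasurable (V j) P := (hident j).aemeasurable_fst
  have hZm (n : ℕ) : AEMeasurable (fun ω => (√(n : ℝ))⁻¹ • ∑ j ∈ Finset.range n, V j ω) P :=
    (Finset.aemeasurable_fun_sum _ fun j _ => hVm j).fun_const_smul _
  have hZm' (n : ℕ) : AEMeasurable (fun ω => (WithLp.toLp 2
      ((√(n : ℝ))⁻¹ • ∑ j ∈ Finset.range n, V j ω) : EuclideanSpace ℝ ι)) P :=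
    (WithLp.measurable_toLp 2 _).comp_aemeasurable (hZm n)
  refine ⟨hZm', aemeasurable_id, ?_⟩
  -- Cramér–Wold: the vector's characteristic function at t is that of the scalar ⟨t, ·⟩ at 1, to
  -- which the one-dimensional theorem applies.
  refine ProbabilityMeasure.tendsto_iff_tendsto_charFun.2 fun t => ?_
  have hf : Measurable fun v : ι → ℝ => t.ofLp ⬝ᵥ v := by
    refine Continuous.measurable ?_
    fun_prop
  have hL2' : MemLp (fun ω => t.ofLp ⬝ᵥ V 0 ω) 2 P := by
    simp only [dotProduct]
    exact memLp_finsetSum _ fun s _ => (hL2 s).const_mul _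
  have hmean' : ∫ ω, t.ofLp ⬝ᵥ V 0 ω ∂P = 0 := by
    simp only [dotProduct]
    rw [integral_finsetSum _ fun s _ => ((hL2 s).integrable (by norm_num)).const_mul _]
    simp [integral_const_mul, hmean]
  have hvar : Var[fun ω => t.ofLp ⬝ᵥ V 0 ω; P] = t.ofLp ⬝ᵥ (C *ᵥ t.ofLp) := by
    rw [variance_of_integral_eq_zero hL2'.aestronglyMeasurable.aemeasurable hmean', ← hcov]
  have hclt := tendstoInDistribution_inv_sqrt_mul_sum_sub (P := P)
    (X := fun j ω => t.ofLp ⬝ᵥ V j ω) (Y := id)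
    (P' := gaussianReal 0 (Var[fun ω => t.ofLp ⬝ᵥ V 0 ω; P]).toNNReal) ⟨aemeasurable_id, by simp⟩
    hL2' (hindep.comp (fun _ v => t.ofLp ⬝ᵥ v) fun _ => hf)
    (fun j => (hident j).comp hf)
  have hlim := ProbabilityMeasure.tendsto_iff_tendsto_charFun.1 hclt.tendsto 1
  simp only [ProbabilityMeasure.coe_mk, Measure.map_id, hmean', mul_zero, sub_zero] at hlim
  rw [charFun_gaussianReal, hvar,
    Real.coe_toNNReal _ (by simpa using hC.dotProduct_mulVec_nonneg t.ofLp)] at hlim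
  simp only [ProbabilityMeasure.coe_mk, Measure.map_id]
  rw [charFun_multivariateGaussian hC]
  convert hlim using 2 with n
  · have hsum : AEMeasurable
        (fun ω => (√(n : ℝ))⁻¹ * ∑ k ∈ Finset.range n, t.ofLp ⬝ᵥ V k ω) P :=
      (Finset.aemeasurable_fun_sum _ fun j _ => hf.comp_aemeasurable (hVm j)).const_mul _
    rw [charFun_apply, charFun_apply, integral_map (hZm' n) (by fun_prop),
      integral_map hsum (by fun_prop)]
    congr 1
    funext ω
    congr 2
    simp [EuclideanSpace.inner_eq_star_dotProduct, dotProduct_smul, dotProduct_sum]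
  · simp

end TendstoGaussian

end Probability

/-! ### Moments of a Gaussian sample and of its product with the residual. -/

section Moments

variable {Ω : Type*} [MeasurableSpace Ω] {P : Measure Ω} {d : ℕ}
  {S : Matrix (Fin d) (Fin d) ℝ} {σ : ℝ≥0} {x : Ω → EuclideanSpace ℝ (Fin d)} {ξ : Ω → ℝ}

lemma ofLp_dotProduct_eq_inner (z : EuclideanSpace ℝ (Fin d)) (v : Fin d → ℝ) :
    z.ofLp ⬝ᵥ v = inner ℝ (WithLp.toLp 2 v) z := by
  simp [EuclideanSpace.inner_eq_star_dotProduct]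

lemma hasGaussianLaw_dotProduct (hx : HasLaw x (multivariateGaussian 0 S) P) (v : Fin d → ℝ) :
    HasGaussianLaw (fun ω => (x ω).ofLp ⬝ᵥ v) P := by
  simp_rw [ofLp_dotProduct_eq_inner]
  exact hx.hasGaussianLaw.map_fun (innerSL ℝ (WithLp.toLp 2 v))

lemma integral_dotProduct (hx : HasLaw x (multivariateGaussian 0 S) P) (v : Fin d → ℝ) :
    ∫ ω, (x ω).ofLp ⬝ᵥ v ∂P = 0 := by
  simp_rw [ofLp_dotProduct_eq_inner]
  rw [integral_inner hx.hasGaussianLaw.integrable, hx.integral_eq]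
  simp

lemma integral_dotProduct_mul_dotProduct (hS : S.PosSemidef)
    (hx : HasLaw x (multivariateGaussian 0 S) P) (u v : Fin d → ℝ) :
    ∫ ω, ((x ω).ofLp ⬝ᵥ u) * ((x ω).ofLp ⬝ᵥ v) ∂P = u ⬝ᵥ (S *ᵥ v) := by
  have := hx.isProbabilityMeasure
  have h1 : cov[fun ω => (x ω).ofLp ⬝ᵥ u, fun ω => (x ω).ofLp ⬝ᵥ v; P] = u ⬝ᵥ (S *ᵥ v) := by
    simp_rw [ofLp_dotProduct_eq_inner]
    rw [hx.covariance_fun_comp (f := fun z => inner ℝ (WithLp.toLp 2 u) z)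
      (g := fun z => inner ℝ (WithLp.toLp 2 v) z) (by fun_prop) (by fun_prop),
      ← covarianceBilin_apply_eq_cov IsGaussian.memLp_two_id,
      covarianceBilin_multivariateGaussian hS]
  rw [← h1, covariance_eq_sub (hasGaussianLaw_dotProduct hx u).memLp_two
    (hasGaussianLaw_dotProduct hx v).memLp_two, integral_dotProduct hx]
  simp

/-- The pair is a linear image of the independent Gaussian pair (x, ξ). Joint Gaussianity is what
later turns zero covariance into independence. -/
lemma hasGaussianLaw_dotProduct_prod
    (hx : HasLaw x (multivariateGaussian 0 S) P) (hξ : HasLaw ξ (gaussianReal 0 (σ ^ 2)) P)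
    (hxξ : IndepFun x ξ P)
    (u w : Fin d → ℝ) :
    HasGaussianLaw (fun ω => ((x ω).ofLp ⬝ᵥ u, (x ω).ofLp ⬝ᵥ w + ξ ω)) P := by
  have h := hxξ.hasGaussianLaw hx.hasGaussianLaw hξ.hasGaussianLaw
  have h2 := h.map_fun
    (((innerSL ℝ (WithLp.toLp 2 u)).comp (ContinuousLinearMap.fst ℝ _ ℝ)).prod
      ((innerSL ℝ (WithLp.toLp 2 w)).comp (ContinuousLinearMap.fst ℝ _ ℝ) +
        ContinuousLinearMap.snd ℝ (EuclideanSpace ℝ (Fin d)) ℝ))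
  simp_rw [ofLp_dotProduct_eq_inner]
  exact h2

lemma integral_dotProduct_add
    (hx : HasLaw x (multivariateGaussian 0 S) P) (hξ : HasLaw ξ (gaussianReal 0 (σ ^ 2)) P)
    (w : Fin d → ℝ) : ∫ ω, ((x ω).ofLp ⬝ᵥ w + ξ ω) ∂P = 0 := by
  rw [integral_add (hasGaussianLaw_dotProduct hx w).integrable hξ.hasGaussianLaw.integrable,
    integral_dotProduct hx, hξ.integral_eq]
  simp

lemma integral_dotProduct_mul_dotProduct_add
    (hS : S.PosSemidef) (hx : HasLaw x (multivariateGaussian 0 S) P)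
    (hξ : HasLaw ξ (gaussianReal 0 (σ ^ 2)) P) (hxξ : IndepFun x ξ P)
    (u w : Fin d → ℝ) :
    ∫ ω, ((x ω).ofLp ⬝ᵥ u) * ((x ω).ofLp ⬝ᵥ w + ξ ω) ∂P = u ⬝ᵥ (S *ᵥ w) := by
  have hind : IndepFun (fun ω => (x ω).ofLp ⬝ᵥ u) ξ P :=
    hxξ.comp (φ := fun z : EuclideanSpace ℝ (Fin d) => z.ofLp ⬝ᵥ u) (ψ := id)
      (Continuous.measurable (by fun_prop)) measurable_id
  have hu := hasGaussianLaw_dotProduct hx u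
  have hw := hasGaussianLaw_dotProduct hx w
  simp_rw [mul_add]
  have h1 : Integrable (fun ω => ((x ω).ofLp ⬝ᵥ u) * ((x ω).ofLp ⬝ᵥ w)) P :=
    hu.memLp_two.integrable_mul hw.memLp_two
  have h2 : Integrable (fun ω => ((x ω).ofLp ⬝ᵥ u) * ξ ω) P :=
    hu.memLp_two.integrable_mul hξ.hasGaussianLaw.memLp_two
  rw [integral_add h1 h2,
    integral_dotProduct_mul_dotProduct hS hx,
    hind.integral_fun_mul_eq_mul_integral hu.aemeasurable.aestronglyMeasurable
      hξ.aemeasurable.aestronglyMeasurable, integral_dotProduct hx, zero_mul, add_zero]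

lemma integral_dotProduct_add_sq
    (hS : S.PosSemidef) (hx : HasLaw x (multivariateGaussian 0 S) P)
    (hξ : HasLaw ξ (gaussianReal 0 (σ ^ 2)) P) (hxξ : IndepFun x ξ P)
    (w : Fin d → ℝ) :
    ∫ ω, ((x ω).ofLp ⬝ᵥ w + ξ ω) ^ 2 ∂P = w ⬝ᵥ (S *ᵥ w) + (σ : ℝ) ^ 2 := by
  have hind : IndepFun (fun ω => (x ω).ofLp ⬝ᵥ w) ξ P :=
    hxξ.comp (φ := fun z : EuclideanSpace ℝ (Fin d) => z.ofLp ⬝ᵥ w) (ψ := id)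
      (Continuous.measurable (by fun_prop)) measurable_id
  have hw := hasGaussianLaw_dotProduct hx w
  have h := hind.variance_fun_add hw.memLp_two hξ.hasGaussianLaw.memLp_two
  rw [variance_of_integral_eq_zero (X := fun ω => (x ω).ofLp ⬝ᵥ w + ξ ω)
      (hw.aemeasurable.add hξ.aemeasurable)
      (integral_dotProduct_add hx hξ w), hξ.variance_eq,
    variance_of_integral_eq_zero hw.aemeasurable (integral_dotProduct hx w)] at h
  rw [h, ← integral_dotProduct_mul_dotProduct hS hx w w]
  simp [sq]

/-- An uncorrelated regressor is independent of the residual. -/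
lemma indepFun_dotProduct_residual
    (hS : S.PosSemidef) (hx : HasLaw x (multivariateGaussian 0 S) P)
    (hξ : HasLaw ξ (gaussianReal 0 (σ ^ 2)) P) (hxξ : IndepFun x ξ P)
    {u w : Fin d → ℝ} (huw : u ⬝ᵥ (S *ᵥ w) = 0) :
    IndepFun (fun ω => (x ω).ofLp ⬝ᵥ u) (fun ω => (x ω).ofLp ⬝ᵥ w + ξ ω) P := by
  have h := hasGaussianLaw_dotProduct_prod hx hξ hxξ u w
  have := hx.isProbabilityMeasure
  refine h.indepFun_of_covariance_eq_zero ?_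
  have h2 := integral_dotProduct_mul_dotProduct_add hS hx hξ hxξ u w
  rw [covariance_eq_sub h.fst.memLp_two h.snd.memLp_two, integral_dotProduct hx, zero_mul,
    sub_zero, ← huw, ← h2]
  rfl

/-- A product of two L² variables need not be in L². Here the squares are independent and
integrable, hence so is their product. -/
lemma memLp_dotProduct_mul_residual
    (hS : S.PosSemidef) (hx : HasLaw x (multivariateGaussian 0 S) P)
    (hξ : HasLaw ξ (gaussianReal 0 (σ ^ 2)) P) (hxξ : IndepFun x ξ P)
    {u w : Fin d → ℝ} (huw : u ⬝ᵥ (S *ᵥ w) = 0) :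
    MemLp (fun ω => ((x ω).ofLp ⬝ᵥ u) * ((x ω).ofLp ⬝ᵥ w + ξ ω)) 2 P := by
  have h := hasGaussianLaw_dotProduct_prod hx hξ hxξ u w
  have h1 : MemLp (fun ω => (x ω).ofLp ⬝ᵥ u) 2 P := h.fst.memLp_two
  have h2 : MemLp (fun ω => (x ω).ofLp ⬝ᵥ w + ξ ω) 2 P := h.snd.memLp_two
  refine (memLp_two_iff_integrable_sq (h1.1.mul h2.1)).2 ?_
  simp only [Pi.mul_apply]
  simp_rw [mul_pow]
  exact ((indepFun_dotProduct_residual hS hx hξ hxξ huw).comp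
    (φ := fun r : ℝ => r ^ 2) (ψ := fun r : ℝ => r ^ 2) (by fun_prop)
    (by fun_prop)).integrable_mul h1.integrable_sq h2.integrable_sq

/-- Independence factors the second moment of the product. The score covariance is therefore the
residual variance times Σ₊, with no fourth-order term. -/
lemma integral_dotProduct_mul_residual_sq
    (hS : S.PosSemidef) (hx : HasLaw x (multivariateGaussian 0 S) P)
    (hξ : HasLaw ξ (gaussianReal 0 (σ ^ 2)) P) (hxξ : IndepFun x ξ P)
    {u w : Fin d → ℝ} (huw : u ⬝ᵥ (S *ᵥ w) = 0) :
    ∫ ω, (((x ω).ofLp ⬝ᵥ u) * ((x ω).ofLp ⬝ᵥ w + ξ ω)) ^ 2 ∂P =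
      (u ⬝ᵥ (S *ᵥ u)) * (w ⬝ᵥ (S *ᵥ w) + (σ : ℝ) ^ 2) := by
  have h := hasGaussianLaw_dotProduct_prod hx hξ hxξ u w
  simp_rw [mul_pow]
  have hind := (indepFun_dotProduct_residual hS hx hξ hxξ huw).comp
    (φ := fun r : ℝ => r ^ 2) (ψ := fun r : ℝ => r ^ 2) (by fun_prop) (by fun_prop)
  have := hind.integral_fun_mul_eq_mul_integral
    (h.fst.aemeasurable.pow_const 2).aestronglyMeasurable
    (h.snd.aemeasurable.pow_const 2).aestronglyMeasurable
  refine this.trans ?_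
  rw [← integral_dotProduct_add_sq hS hx hξ hxξ w, ← integral_dotProduct_mul_dotProduct hS hx u u]
  simp [sq]

end Moments

/-! ### Deterministic identities for least squares. -/

section LeastSquares

variable {n p : ℕ}

lemma ols_mulVec_add {A : Matrix (Fin n) (Fin p) ℝ} (hA : IsUnit (Aᵀ * A).det)
    (t : Fin p → ℝ) (ε : Fin n → ℝ) :
    ols A (A *ᵥ t + ε) - t = (Aᵀ * A)⁻¹ *ᵥ (Aᵀ *ᵥ ε) := by
  rw [ols, mulVec_add, mulVec_add, mulVec_mulVec _ Aᵀ A, mulVec_mulVec, nonsing_inv_mul _ hA,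
    one_mulVec, add_sub_cancel_left]

lemma sampleCov_inv {A : Matrix (Fin n) (Fin p) ℝ} (hn : n ≠ 0) (hA : IsUnit (Aᵀ * A).det) :
    (sampleCov A)⁻¹ = (n : ℝ) • (Aᵀ * A)⁻¹ := by
  have hn' : (n : ℝ) ≠ 0 := Nat.cast_ne_zero.2 hn
  refine inv_eq_left_inv ?_
  rw [sampleCov, smul_mul_smul_comm, mul_inv_cancel₀ hn', nonsing_inv_mul _ hA, one_smul]

lemma sampleCov_posSemidef (A : Matrix (Fin n) (Fin p) ℝ) : (sampleCov A).PosSemidef := by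
  have := posSemidef_conjTranspose_mul_self A
  rw [conjTranspose_eq_transpose_of_trivial] at this
  exact this.smul (by positivity)

lemma isUnit_det_of_sampleCov {A : Matrix (Fin n) (Fin p) ℝ}
    (hA : IsUnit (sampleCov A).det) : IsUnit (Aᵀ * A).det := by
  rw [sampleCov, det_smul] at hA
  exact isUnit_of_mul_isUnit_right hA

/-- The estimation error of least squares in terms of sample averages. -/
lemma ols_sub_eq {A : Matrix (Fin n) (Fin p) ℝ} (hn : n ≠ 0) (hA : IsUnit (sampleCov A).det)
    (t : Fin p → ℝ) (ε : Fin n → ℝ) :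
    ols A (A *ᵥ t + ε) - t = (sampleCov A)⁻¹ *ᵥ ((n : ℝ)⁻¹ • (Aᵀ *ᵥ ε)) := by
  have hn' : (n : ℝ) ≠ 0 := Nat.cast_ne_zero.2 hn
  rw [ols_mulVec_add (isUnit_det_of_sampleCov hA), sampleCov_inv hn (isUnit_det_of_sampleCov hA),
    smul_mulVec, mulVec_smul, smul_smul, mul_inv_cancel₀ hn', one_smul]

/-- Pythagoras: the fitted residual is the noise minus its projection onto the columns of A. The
subtracted term is quadratic in the estimation error and vanishes asymptotically. -/
lemma trainError_eq {A : Matrix (Fin n) (Fin p) ℝ} (hA : IsUnit (sampleCov A).det)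
    (t : Fin p → ℝ) (ε : Fin n → ℝ) :
    trainError A (A *ᵥ t + ε) = (n : ℝ)⁻¹ * (ε ⬝ᵥ ε) -
      quad (sampleCov A) (ols A (A *ᵥ t + ε) - t) := by
  have hδ := ols_mulVec_add (isUnit_det_of_sampleCov hA) t ε
  have hres (j) : (A *ᵥ ols A (A *ᵥ t + ε)) j - (A *ᵥ t + ε) j =
      (A *ᵥ (ols A (A *ᵥ t + ε) - t) - ε) j := by
    simp only [mulVec_sub, Pi.sub_apply, Pi.add_apply]; ring
  rw [trainError]
  simp_rw [hres]
  set δ := ols A (A *ᵥ t + ε) - t with hδdef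
  have hnormal : (Aᵀ * A) *ᵥ δ = Aᵀ *ᵥ ε := by
    rw [hδ, mulVec_mulVec, mul_nonsing_inv _ (isUnit_det_of_sampleCov hA), one_mulVec]
  have hsum : ∑ j, (A *ᵥ δ - ε) j ^ 2 = (A *ᵥ δ - ε) ⬝ᵥ (A *ᵥ δ - ε) := by
    simp [dotProduct, sq]
  have h1 : A *ᵥ δ ⬝ᵥ A *ᵥ δ = δ ⬝ᵥ (Aᵀ *ᵥ ε) := by
    rw [← hnormal, ← mulVec_mulVec, dotProduct_mulVec δ, vecMul_transpose]
  have h2 : A *ᵥ δ ⬝ᵥ ε = δ ⬝ᵥ (Aᵀ *ᵥ ε) := by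
    rw [dotProduct_mulVec δ, vecMul_transpose]
  have h3 : quad (sampleCov A) δ = (n : ℝ)⁻¹ * (δ ⬝ᵥ (Aᵀ *ᵥ ε)) := by
    rw [quad, sampleCov, smul_mulVec, hnormal, dotProduct_smul, smul_eq_mul]
  rw [hsum, h3, dotProduct_sub, sub_dotProduct, sub_dotProduct, h1, h2, dotProduct_comm ε, h2]
  ring

end LeastSquares

/-! ### Observed vectors as linear forms on all features. -/

section Extension

variable {p q d : ℕ}

/-- Extension by zero `Π₊ᵀ t` of a vector of observed coordinates. -/
def extend (e : Fin p ⊕ Fin q ≃ Fin d) (t : Fin p → ℝ) : Fin d → ℝ :=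
  fun k => Sum.elim t 0 (e.symm k)

lemma obs_extend (e : Fin p ⊕ Fin q ≃ Fin d) (t : Fin p → ℝ) : obs e (extend e t) = t := by
  ext a; simp [obs, extend]

lemma unobs_extend (e : Fin p ⊕ Fin q ≃ Fin d) (t : Fin p → ℝ) : unobs e (extend e t) = 0 := by
  ext a; simp [unobs, extend]

lemma dotProduct_extend (e : Fin p ⊕ Fin q ≃ Fin d) (v : Fin d → ℝ) (t : Fin p → ℝ) :
    v ⬝ᵥ extend e t = obs e v ⬝ᵥ t := by
  simp [dotProduct_eq_obs_add_unobs e, obs_extend, unobs_extend]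

lemma extend_dotProduct_mulVec_extend (e : Fin p ⊕ Fin q ≃ Fin d) (S : Matrix (Fin d) (Fin d) ℝ)
    (s t : Fin p → ℝ) : extend e s ⬝ᵥ (S *ᵥ extend e t) = s ⬝ᵥ (blockPP e S *ᵥ t) := by
  rw [dotProduct_comm, dotProduct_extend, obs_mulVec, obs_extend, unobs_extend, mulVec_zero,
    add_zero, dotProduct_comm]

lemma extend_dotProduct_mulVec_residualDirection (e : Fin p ⊕ Fin q ≃ Fin d)
    {S : Matrix (Fin d) (Fin d) ℝ} (hS : S.PosDef) (θ : Fin d → ℝ) (t : Fin p → ℝ) :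
    extend e t ⬝ᵥ (S *ᵥ residualDirection e S θ) = 0 := by
  rw [dotProduct_comm, dotProduct_extend, obs_mulVec_residualDirection e hS, zero_dotProduct]

lemma apply_eq_dotProduct_extend (e : Fin p ⊕ Fin q ≃ Fin d) (v : Fin d → ℝ) (a : Fin p) :
    v (e (Sum.inl a)) = v ⬝ᵥ extend e (Pi.single a 1) := by
  rw [dotProduct_extend]
  simp [obs]

end Extension

/-! ### The strong law for functions of the samples. -/

section LawOfLargeNumbers

variable {Ω 𝓧 : Type*} [MeasurableSpace Ω] [MeasurableSpace 𝓧] {P : Measure Ω}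

lemma tendsto_average_ae {X : ℕ → Ω → 𝓧} (hindep : iIndepFun X P)
    (hident : ∀ j, IdentDistrib (X j) (X 0) P P) {f : 𝓧 → ℝ} (hf : Measurable f)
    (hint : Integrable (fun ω => f (X 0 ω)) P) :
    ∀ᵐ ω ∂P, Tendsto (fun n : ℕ => (n : ℝ)⁻¹ * ∑ j ∈ Finset.range n, f (X j ω)) atTop
      (𝓝 (∫ ω, f (X 0 ω) ∂P)) := by
  have h := strong_law_ae_real (fun j ω => f (X j ω)) hint
    (fun j k hjk => (hindep.indepFun hjk).comp hf hf) (fun j => (hident j).comp hf)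
  filter_upwards [h] with ω hω
  simpa [div_eq_inv_mul] using hω

end LawOfLargeNumbers

/-! ### One agent: the effective regression model and its almost sure limits. -/

section OneAgentAsymptotics

variable {Ω : Type*} {p q d : ℕ}

/-- The regression residual `y - ⟨x₊, T θ⟩` of the `j`-th sample. -/
def effectiveNoise (e : Fin p ⊕ Fin q ≃ Fin d) (S : Matrix (Fin d) (Fin d) ℝ)
    (θ : Fin d → ℝ) (x : ℕ → Ω → EuclideanSpace ℝ (Fin d)) (ξ : ℕ → Ω → ℝ) (j : ℕ) (ω : Ω) : ℝ :=
  (x j ω).ofLp ⬝ᵥ residualDirection e S θ + ξ j ω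

/-- The score `x₊ (y - ⟨x₊, T θ⟩)` of the `j`-th sample. -/
def score (e : Fin p ⊕ Fin q ≃ Fin d) (S : Matrix (Fin d) (Fin d) ℝ)
    (θ : Fin d → ℝ) (x : ℕ → Ω → EuclideanSpace ℝ (Fin d)) (ξ : ℕ → Ω → ℝ) (j : ℕ) (ω : Ω) :
    Fin p → ℝ :=
  effectiveNoise e S θ x ξ j ω • obs e (x j ω).ofLp

/-- The sample second-moment matrix of the observed features. -/
abbrev localCov (e : Fin p ⊕ Fin q ≃ Fin d)
    (x : ℕ → Ω → EuclideanSpace ℝ (Fin d)) (n : ℕ) (ω : Ω) : Matrix (Fin p) (Fin p) ℝ :=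
  sampleCov (obsData e (dataMatrix x n ω))

/-- The unobserved features are absorbed partly into the coefficient Tθ and partly into the noise,
so the least squares identities apply with true parameter Tθ. -/
lemma labels_eq (e : Fin p ⊕ Fin q ≃ Fin d) (S : Matrix (Fin d) (Fin d) ℝ)
    (θ : Fin d → ℝ) (x : ℕ → Ω → EuclideanSpace ℝ (Fin d)) (ξ : ℕ → Ω → ℝ) (n : ℕ) (ω : Ω) :
    labels θ x ξ n ω = obsData e (dataMatrix x n ω) *ᵥ (transfer e S *ᵥ θ) +
      fun j : Fin n => effectiveNoise e S θ x ξ j ω := by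
  ext j
  have h := dotProduct_eq_transfer_add_residual e S θ (x j ω).ofLp
  change (x j ω).ofLp ⬝ᵥ θ + ξ j ω = obs e (x j ω).ofLp ⬝ᵥ (transfer e S *ᵥ θ) +
    ((x j ω).ofLp ⬝ᵥ residualDirection e S θ + ξ j ω)
  rw [h, add_assoc]

lemma localCov_apply (e : Fin p ⊕ Fin q ≃ Fin d) (x : ℕ → Ω → EuclideanSpace ℝ (Fin d)) (n : ℕ)
    (ω : Ω) (a b : Fin p) : localCov e x n ω a b =
      (n : ℝ)⁻¹ * ∑ j ∈ Finset.range n, x j ω (e (Sum.inl a)) * x j ω (e (Sum.inl b)) := by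
  rw [Finset.sum_range]
  rfl

lemma transpose_mulVec_effectiveNoise (e : Fin p ⊕ Fin q ≃ Fin d) (S : Matrix (Fin d) (Fin d) ℝ)
    (θ : Fin d → ℝ) (x : ℕ → Ω → EuclideanSpace ℝ (Fin d)) (ξ : ℕ → Ω → ℝ) (n : ℕ) (ω : Ω) :
    ((obsData e (dataMatrix x n ω))ᵀ *ᵥ fun j : Fin n => effectiveNoise e S θ x ξ j ω) =
      ∑ j ∈ Finset.range n, score e S θ x ξ j ω := by
  ext a
  rw [Finset.sum_apply, Finset.sum_range]
  simp only [mulVec, dotProduct]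
  refine Finset.sum_congr rfl fun j _ => ?_
  simp [score, obs, obsData, dataMatrix, mul_comm]

lemma localOLS_sub_eq (e : Fin p ⊕ Fin q ≃ Fin d) (S : Matrix (Fin d) (Fin d) ℝ)
    (θ : Fin d → ℝ) (x : ℕ → Ω → EuclideanSpace ℝ (Fin d)) (ξ : ℕ → Ω → ℝ) {n : ℕ} {ω : Ω}
    (hn : n ≠ 0) (hdet : IsUnit (localCov e x n ω).det) :
    localOLS e θ x ξ n ω - transfer e S *ᵥ θ =
      (localCov e x n ω)⁻¹ *ᵥ ((n : ℝ)⁻¹ • ∑ j ∈ Finset.range n, score e S θ x ξ j ω) := by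
  rw [localOLS, labels_eq e S, ols_sub_eq hn hdet, transpose_mulVec_effectiveNoise]

lemma localError_eq (e : Fin p ⊕ Fin q ≃ Fin d) (S : Matrix (Fin d) (Fin d) ℝ)
    (θ : Fin d → ℝ) (x : ℕ → Ω → EuclideanSpace ℝ (Fin d)) (ξ : ℕ → Ω → ℝ) {n : ℕ} {ω : Ω}
    (hdet : IsUnit (localCov e x n ω).det) :
    localError e θ x ξ n ω =
      (n : ℝ)⁻¹ * ∑ j ∈ Finset.range n, effectiveNoise e S θ x ξ j ω ^ 2 -
        quad (localCov e x n ω) (localOLS e θ x ξ n ω - transfer e S *ᵥ θ) := by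
  rw [localError, localOLS, labels_eq e S, trainError_eq hdet, Finset.sum_range]
  simp [dotProduct, sq]

lemma score_dotProduct (e : Fin p ⊕ Fin q ≃ Fin d) (S : Matrix (Fin d) (Fin d) ℝ)
    (θ : Fin d → ℝ) (x : ℕ → Ω → EuclideanSpace ℝ (Fin d)) (ξ : ℕ → Ω → ℝ) (j : ℕ) (ω : Ω)
    (t : Fin p → ℝ) :
    score e S θ x ξ j ω ⬝ᵥ t =
      ((x j ω).ofLp ⬝ᵥ extend e t) * ((x j ω).ofLp ⬝ᵥ residualDirection e S θ + ξ j ω) := by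
  rw [score, smul_dotProduct, dotProduct_extend, effectiveNoise, smul_eq_mul, mul_comm]

variable [MeasurableSpace Ω] {P : Measure Ω} {S : Matrix (Fin d) (Fin d) ℝ}
  {θ : Fin d → ℝ} {σ : ℝ≥0} {x : ℕ → Ω → EuclideanSpace ℝ (Fin d)} {ξ : ℕ → Ω → ℝ}

lemma identDistrib_sample [IsProbabilityMeasure P]
    (hx : ∀ j, HasLaw (x j) (multivariateGaussian 0 S) P)
    (hξ : ∀ j, HasLaw (ξ j) (gaussianReal 0 (σ ^ 2)) P) (hxξ : ∀ j, IndepFun (x j) (ξ j) P)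
    (j : ℕ) : IdentDistrib (fun ω => (x j ω, ξ j ω)) (fun ω => (x 0 ω, ξ 0 ω)) P P :=
  IdentDistrib.prodMk
    ⟨(hx j).aemeasurable, (hx 0).aemeasurable, (hx j).map_eq.trans (hx 0).map_eq.symm⟩
    ⟨(hξ j).aemeasurable, (hξ 0).aemeasurable, (hξ j).map_eq.trans (hξ 0).map_eq.symm⟩
    (hxξ j) (hxξ 0)

lemma memLp_score (e : Fin p ⊕ Fin q ≃ Fin d) (hS : S.PosDef)
    (hx : ∀ j, HasLaw (x j) (multivariateGaussian 0 S) P)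
    (hξ : ∀ j, HasLaw (ξ j) (gaussianReal 0 (σ ^ 2)) P) (hxξ : ∀ j, IndepFun (x j) (ξ j) P)
    (j : ℕ) (t : Fin p → ℝ) : MemLp (fun ω => score e S θ x ξ j ω ⬝ᵥ t) 2 P := by
  simp_rw [score_dotProduct]
  exact memLp_dotProduct_mul_residual hS.posSemidef (hx j) (hξ j) (hxξ j)
    (extend_dotProduct_mulVec_residualDirection e hS θ t)

lemma integral_score (e : Fin p ⊕ Fin q ≃ Fin d) (hS : S.PosDef)
    (hx : ∀ j, HasLaw (x j) (multivariateGaussian 0 S) P)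
    (hξ : ∀ j, HasLaw (ξ j) (gaussianReal 0 (σ ^ 2)) P) (hxξ : ∀ j, IndepFun (x j) (ξ j) P)
    (j : ℕ) (t : Fin p → ℝ) : ∫ ω, score e S θ x ξ j ω ⬝ᵥ t ∂P = 0 := by
  simp_rw [score_dotProduct]
  rw [integral_dotProduct_mul_dotProduct_add hS.posSemidef (hx j) (hξ j) (hxξ j),
    extend_dotProduct_mulVec_residualDirection e hS]

lemma integral_score_sq (e : Fin p ⊕ Fin q ≃ Fin d) (hS : S.PosDef)
    (hx : ∀ j, HasLaw (x j) (multivariateGaussian 0 S) P)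
    (hξ : ∀ j, HasLaw (ξ j) (gaussianReal 0 (σ ^ 2)) P) (hxξ : ∀ j, IndepFun (x j) (ξ j) P)
    (j : ℕ) (t : Fin p → ℝ) :
    ∫ ω, (score e S θ x ξ j ω ⬝ᵥ t) ^ 2 ∂P =
      t ⬝ᵥ ((residualVariance e S θ σ • blockPP e S) *ᵥ t) := by
  have hw := quad_residualDirection e hS θ
  rw [quad] at hw
  simp_rw [score_dotProduct]
  rw [integral_dotProduct_mul_residual_sq hS.posSemidef (hx j) (hξ j) (hxξ j)
    (extend_dotProduct_mulVec_residualDirection e hS θ t), extend_dotProduct_mulVec_extend,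
    hw, ← residualVariance, smul_mulVec, dotProduct_smul,
    smul_eq_mul, mul_comm]

lemma tendsto_localCov_ae [IsProbabilityMeasure P] (e : Fin p ⊕ Fin q ≃ Fin d) (hS : S.PosDef)
    (hx : ∀ j, HasLaw (x j) (multivariateGaussian 0 S) P)
    (hξ : ∀ j, HasLaw (ξ j) (gaussianReal 0 (σ ^ 2)) P) (hxξ : ∀ j, IndepFun (x j) (ξ j) P)
    (hindep : iIndepFun (fun j ω => (x j ω, ξ j ω)) P) :
    ∀ᵐ ω ∂P, Tendsto (fun n => localCov e x n ω) atTop (𝓝 (blockPP e S)) := by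
  have h (a b : Fin p) : ∀ᵐ ω ∂P, Tendsto (fun n => localCov e x n ω a b) atTop
      (𝓝 (blockPP e S a b)) := by
    have hint := (hasGaussianLaw_dotProduct (hx 0)
      (extend e (Pi.single a 1))).memLp_two.integrable_mul
      (hasGaussianLaw_dotProduct (hx 0) (extend e (Pi.single b 1))).memLp_two
    have hlln := tendsto_average_ae hindep (identDistrib_sample hx hξ hxξ)
      (f := fun z => (z.1.ofLp ⬝ᵥ extend e (Pi.single a 1)) *
        (z.1.ofLp ⬝ᵥ extend e (Pi.single b 1)))
      (Continuous.measurable (by fun_prop)) hint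
    rw [integral_dotProduct_mul_dotProduct hS.posSemidef (hx 0),
      extend_dotProduct_mulVec_extend] at hlln
    filter_upwards [hlln] with ω hω
    simp_rw [localCov_apply, apply_eq_dotProduct_extend e]
    simpa using hω
  filter_upwards [ae_all_iff.2 fun a => ae_all_iff.2 (h a)] with ω hω
  exact tendsto_pi_nhds.2 fun a => tendsto_pi_nhds.2 (hω a)

lemma tendsto_average_score_ae [IsProbabilityMeasure P] (e : Fin p ⊕ Fin q ≃ Fin d)
    (hS : S.PosDef) (hx : ∀ j, HasLaw (x j) (multivariateGaussian 0 S) P)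
    (hξ : ∀ j, HasLaw (ξ j) (gaussianReal 0 (σ ^ 2)) P) (hxξ : ∀ j, IndepFun (x j) (ξ j) P)
    (hindep : iIndepFun (fun j ω => (x j ω, ξ j ω)) P) :
    ∀ᵐ ω ∂P, Tendsto (fun n : ℕ => (n : ℝ)⁻¹ • ∑ j ∈ Finset.range n, score e S θ x ξ j ω) atTop
      (𝓝 0) := by
  have h (a : Fin p) : ∀ᵐ ω ∂P, Tendsto (fun n : ℕ =>
      ((n : ℝ)⁻¹ • ∑ j ∈ Finset.range n, score e S θ x ξ j ω) a) atTop (𝓝 0) := by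
    have hint := (memLp_score (θ := θ) e hS hx hξ hxξ 0 (Pi.single a 1)).integrable (by norm_num)
    have hzero := integral_score (θ := θ) e hS hx hξ hxξ 0 (Pi.single a 1)
    simp_rw [score_dotProduct] at hint hzero
    have hlln := tendsto_average_ae hindep (identDistrib_sample hx hξ hxξ)
      (f := fun z => (z.1.ofLp ⬝ᵥ extend e (Pi.single a 1)) *
        (z.1.ofLp ⬝ᵥ residualDirection e S θ + z.2))
      (Continuous.measurable (by fun_prop)) hint
    rw [hzero] at hlln
    filter_upwards [hlln] with ω hω
    simp_rw [← score_dotProduct e S θ] at hω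
    simpa using hω
  filter_upwards [ae_all_iff.2 h] with ω hω
  exact tendsto_pi_nhds.2 hω

lemma tendsto_average_effectiveNoise_sq_ae [IsProbabilityMeasure P] (e : Fin p ⊕ Fin q ≃ Fin d)
    (hS : S.PosDef) (hx : ∀ j, HasLaw (x j) (multivariateGaussian 0 S) P)
    (hξ : ∀ j, HasLaw (ξ j) (gaussianReal 0 (σ ^ 2)) P) (hxξ : ∀ j, IndepFun (x j) (ξ j) P)
    (hindep : iIndepFun (fun j ω => (x j ω, ξ j ω)) P) :
    ∀ᵐ ω ∂P, Tendsto (fun n : ℕ =>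
      (n : ℝ)⁻¹ * ∑ j ∈ Finset.range n, effectiveNoise e S θ x ξ j ω ^ 2) atTop
      (𝓝 (residualVariance e S θ σ)) := by
  have hL2 : MemLp (fun ω => (x 0 ω).ofLp ⬝ᵥ residualDirection e S θ + ξ 0 ω) 2 P :=
    (hasGaussianLaw_dotProduct_prod (hx 0) (hξ 0) (hxξ 0) 0 _).snd.memLp_two
  have hlln := tendsto_average_ae hindep (identDistrib_sample hx hξ hxξ)
    (f := fun z => (z.1.ofLp ⬝ᵥ residualDirection e S θ + z.2) ^ 2)
    (Continuous.measurable (by fun_prop)) hL2.integrable_sq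
  rw [integral_dotProduct_add_sq hS.posSemidef (hx 0) (hξ 0) (hxξ 0), ← quad,
    quad_residualDirection e hS, ← residualVariance] at hlln
  exact hlln

lemma eventually_isUnit_det_of_tendsto {ι : Type*} [Fintype ι] [DecidableEq ι]
    {A : ℕ → Matrix ι ι ℝ} {B : Matrix ι ι ℝ} (hB : IsUnit B.det) (h : Tendsto A atTop (𝓝 B)) :
    ∀ᶠ n in atTop, IsUnit (A n).det := by
  have := ((Continuous.matrix_det continuous_id).tendsto B).comp h
  filter_upwards [this.eventually_ne hB.ne_zero] with n hn using isUnit_iff_ne_zero.2 hn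

/-- The training error converges almost surely to the residual variance. -/
lemma tendsto_localError_ae [IsProbabilityMeasure P] (e : Fin p ⊕ Fin q ≃ Fin d)
    (hS : S.PosDef) (hx : ∀ j, HasLaw (x j) (multivariateGaussian 0 S) P)
    (hξ : ∀ j, HasLaw (ξ j) (gaussianReal 0 (σ ^ 2)) P) (hxξ : ∀ j, IndepFun (x j) (ξ j) P)
    (hindep : iIndepFun (fun j ω => (x j ω, ξ j ω)) P) :
    ∀ᵐ ω ∂P, Tendsto (fun n => localError e θ x ξ n ω) atTop
      (𝓝 (residualVariance e S θ σ)) := by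
  filter_upwards [tendsto_localCov_ae e hS hx hξ hxξ hindep,
    tendsto_average_score_ae (θ := θ) e hS hx hξ hxξ hindep,
    tendsto_average_effectiveNoise_sq_ae (θ := θ) e hS hx hξ hxξ hindep] with ω hcov hscore hnoise
  have hunit := (blockPP_posDef e hS).isUnit_det
  have hquad : Continuous fun z :
      Matrix (Fin p) (Fin p) ℝ × Matrix (Fin p) (Fin p) ℝ × (Fin p → ℝ) =>
      quad z.1 (z.2.1 *ᵥ z.2.2) := by
    unfold quad
    fun_prop
  -- The correction in the training error is a continuous function of the sample covariance, its
  -- inverse and the average score. The last tends to 0, and so does the correction.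
  have hlim := (hquad.tendsto (blockPP e S, (blockPP e S)⁻¹, 0)).comp
    (hcov.prodMk_nhds ((tendsto_matrix_inv hunit hcov).prodMk_nhds hscore))
  have h0 : quad (blockPP e S) ((blockPP e S)⁻¹ *ᵥ 0) = 0 := by simp [quad]
  have hsub := hnoise.sub hlim
  simp only [h0, sub_zero] at hsub
  refine hsub.congr' ?_
  filter_upwards [eventually_isUnit_det_of_tendsto hunit hcov, eventually_ne_atTop 0] with n hdet hn
  rw [localError_eq e S θ x ξ hdet, localOLS_sub_eq e S θ x ξ hn hdet]
  rfl

end OneAgentAsymptotics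

/-! ### Measurability of random matrix expressions. -/

section MatrixMeasurability

variable {Ω : Type*} [MeasurableSpace Ω] {P : Measure Ω} {ι κ l : Type*} [Fintype κ]

lemma aemeasurable_matrix_mul_apply {A : Ω → Matrix ι κ ℝ} {B : Ω → Matrix κ l ℝ}
    (hA : ∀ a b, AEMeasurable (fun ω => A ω a b) P)
    (hB : ∀ a b, AEMeasurable (fun ω => B ω a b) P) (a : ι) (b : l) :
    AEMeasurable (fun ω => (A ω * B ω) a b) P := by
  simp_rw [Matrix.mul_apply]
  exact Finset.aemeasurable_fun_sum _ fun k _ => (hA a k).mul (hB k b)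

lemma aemeasurable_matrix_mulVec_apply {A : Ω → Matrix ι κ ℝ} {v : Ω → κ → ℝ}
    (hA : ∀ a b, AEMeasurable (fun ω => A ω a b) P)
    (hv : ∀ b, AEMeasurable (fun ω => v ω b) P) (a : ι) :
    AEMeasurable (fun ω => (A ω *ᵥ v ω) a) P := by
  simp only [mulVec, dotProduct]
  exact Finset.aemeasurable_fun_sum _ fun k _ => (hA a k).mul (hv k)

lemma aemeasurable_matrix_inv_apply [Fintype ι] [DecidableEq ι] {A : Ω → Matrix ι ι ℝ}
    (hA : ∀ a b, AEMeasurable (fun ω => A ω a b) P) (a b : ι) :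
    AEMeasurable (fun ω => (A ω)⁻¹ a b) P := by
  have h : AEMeasurable (fun ω a b => A ω a b) P :=
    aemeasurable_pi_lambda _ fun a => aemeasurable_pi_lambda _ fun b => hA a b
  have h2 := measurable_matrix_inv.comp_aemeasurable h
  exact aemeasurable_pi_iff.1 (aemeasurable_pi_iff.1 h2 a) b

end MatrixMeasurability

/-! ### Measurability of the local statistics. -/

section OneAgentMeasurability

variable {Ω : Type*} [MeasurableSpace Ω] {P : Measure Ω} {p q d : ℕ}
  {x : ℕ → Ω → EuclideanSpace ℝ (Fin d)} {ξ : ℕ → Ω → ℝ}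

lemma aemeasurable_feature (hx : ∀ j, AEMeasurable (x j) P) (j : ℕ) (k : Fin d) :
    AEMeasurable (fun ω => x j ω k) P :=
  Measurable.comp_aemeasurable (g := fun z : EuclideanSpace ℝ (Fin d) => z k) (by fun_prop) (hx j)

lemma aemeasurable_labels (θ : Fin d → ℝ) (hx : ∀ j, AEMeasurable (x j) P)
    (hξ : ∀ j, AEMeasurable (ξ j) P) (n : ℕ) (j : Fin n) :
    AEMeasurable (fun ω => labels θ x ξ n ω j) P :=
  (aemeasurable_matrix_mulVec_apply (A := fun ω => dataMatrix x n ω) (v := fun _ => θ)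
    (fun j k => aemeasurable_feature hx j k) (fun _ => aemeasurable_const) j).add (hξ j)

lemma aemeasurable_localCov (e : Fin p ⊕ Fin q ≃ Fin d) (hx : ∀ j, AEMeasurable (x j) P)
    (n : ℕ) (a b : Fin p) : AEMeasurable (fun ω => localCov e x n ω a b) P := by
  simp_rw [localCov_apply]
  exact (Finset.aemeasurable_fun_sum _ fun j _ => (aemeasurable_feature hx j _).mul
    (aemeasurable_feature hx j _)).const_mul _

lemma aemeasurable_localOLS (e : Fin p ⊕ Fin q ≃ Fin d) (θ : Fin d → ℝ)
    (hx : ∀ j, AEMeasurable (x j) P) (hξ : ∀ j, AEMeasurable (ξ j) P) (n : ℕ) (a : Fin p) :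
    AEMeasurable (fun ω => localOLS e θ x ξ n ω a) P := by
  have hA (j : Fin n) (a : Fin p) :
      AEMeasurable (fun ω => obsData e (dataMatrix x n ω) j a) P :=
    aemeasurable_feature hx j _
  exact aemeasurable_matrix_mulVec_apply
    (aemeasurable_matrix_inv_apply (aemeasurable_matrix_mul_apply
      (A := fun ω => (obsData e (dataMatrix x n ω))ᵀ) (fun a j => hA j a) hA))
    (aemeasurable_matrix_mulVec_apply (A := fun ω => (obsData e (dataMatrix x n ω))ᵀ)
      (fun a j => hA j a) (aemeasurable_labels θ hx hξ n)) a

lemma aemeasurable_localError (e : Fin p ⊕ Fin q ≃ Fin d) (θ : Fin d → ℝ)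
    (hx : ∀ j, AEMeasurable (x j) P) (hξ : ∀ j, AEMeasurable (ξ j) P) (n : ℕ) :
    AEMeasurable (fun ω => localError e θ x ξ n ω) P := by
  have hA (j : Fin n) (a : Fin p) :
      AEMeasurable (fun ω => obsData e (dataMatrix x n ω) j a) P :=
    aemeasurable_feature hx j _
  exact (Finset.aemeasurable_fun_sum _ fun j _ =>
    ((aemeasurable_matrix_mulVec_apply hA (aemeasurable_localOLS e θ hx hξ n) j).sub
      (aemeasurable_labels θ hx hξ n j)).pow_const 2).const_mul _

end OneAgentMeasurability

/-! ### Block diagonal matrices and block rows over the agents. -/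

section Stacking

variable {m : ℕ} {p : Fin m → ℕ}

lemma blockDiagonal'_mulVec_apply (D : ∀ i, Matrix (Fin (p i)) (Fin (p i)) ℝ)
    (v : (Σ i, Fin (p i)) → ℝ) (i : Fin m) (a : Fin (p i)) :
    (blockDiagonal' D *ᵥ v) ⟨i, a⟩ = (D i *ᵥ fun b => v ⟨i, b⟩) a := by
  simp only [mulVec, dotProduct]
  rw [Fintype.sum_sigma, Finset.sum_eq_single i]
  · simp
  · intro j _ hj
    exact Finset.sum_eq_zero fun b _ => by rw [blockDiagonal'_apply_ne _ _ _ hj.symm, zero_mul]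
  · simp

lemma dotProduct_blockDiagonal'_mulVec (D : ∀ i, Matrix (Fin (p i)) (Fin (p i)) ℝ)
    (v : (Σ i, Fin (p i)) → ℝ) :
    v ⬝ᵥ (blockDiagonal' D *ᵥ v) =
      ∑ i, (fun a => v ⟨i, a⟩) ⬝ᵥ (D i *ᵥ fun a => v ⟨i, a⟩) := by
  rw [dotProduct, Fintype.sum_sigma]
  simp_rw [blockDiagonal'_mulVec_apply]
  rfl

lemma blockDiagonal'_posSemidef {D : ∀ i, Matrix (Fin (p i)) (Fin (p i)) ℝ}
    (hD : ∀ i, (D i).PosSemidef) : (blockDiagonal' D).PosSemidef := by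
  refine .of_dotProduct_mulVec_nonneg
    (isHermitian_blockDiagonal'_iff.2 fun i => (hD i).isHermitian) fun v => ?_
  rw [star_trivial, dotProduct_blockDiagonal'_mulVec]
  exact Finset.sum_nonneg fun i _ => by
    simpa using (hD i).dotProduct_mulVec_nonneg fun a => v ⟨i, a⟩

/-- The block row `[B₁ ⋯ Bₘ]`. -/
def blockRow {κ : Type*} (B : ∀ i, Matrix κ (Fin (p i)) ℝ) : Matrix κ (Σ i, Fin (p i)) ℝ :=
  Matrix.of fun k s => B s.1 k s.2

lemma blockRow_mulVec {κ : Type*} (B : ∀ i, Matrix κ (Fin (p i)) ℝ)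
    (v : (Σ i, Fin (p i)) → ℝ) : blockRow B *ᵥ v = ∑ i, B i *ᵥ fun a => v ⟨i, a⟩ := by
  ext k
  rw [Finset.sum_apply]
  simp only [mulVec, dotProduct]
  rw [Fintype.sum_sigma]
  rfl

lemma blockRow_mul_blockDiagonal' {κ : Type*} (B : ∀ i, Matrix κ (Fin (p i)) ℝ)
    (D : ∀ i, Matrix (Fin (p i)) (Fin (p i)) ℝ) :
    blockRow B * blockDiagonal' D = blockRow fun i => B i * D i := by
  ext k ⟨i, a⟩
  rw [Matrix.mul_apply, Fintype.sum_sigma, Finset.sum_eq_single i]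
  · simp [blockRow, Matrix.mul_apply]
  · intro j _ hj
    exact Finset.sum_eq_zero fun b _ => by rw [blockDiagonal'_apply_ne _ _ _ hj, mul_zero]
  · simp

lemma blockRow_mul_transpose {κ : Type*} (A B : ∀ i, Matrix κ (Fin (p i)) ℝ) :
    blockRow A * (blockRow B)ᵀ = ∑ i, A i * (B i)ᵀ := by
  ext k k'
  rw [Matrix.mul_apply, Fintype.sum_sigma, Matrix.sum_apply]
  simp [blockRow, Matrix.mul_apply]

lemma tendsto_blockRow {κ α : Type*} {f : Filter α} {B : α → ∀ i, Matrix κ (Fin (p i)) ℝ}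
    {C : ∀ i, Matrix κ (Fin (p i)) ℝ} (h : ∀ i, Tendsto (fun x => B x i) f (𝓝 (C i))) :
    Tendsto (fun x => blockRow (B x)) f (𝓝 (blockRow C)) :=
  tendsto_pi_nhds.2 fun k => tendsto_pi_nhds.2 fun s =>
    tendsto_pi_nhds.1 (tendsto_pi_nhds.1 (h s.1) k) s.2

lemma tendsto_blockDiagonal' {α : Type*} {f : Filter α}
    {D : α → ∀ i, Matrix (Fin (p i)) (Fin (p i)) ℝ} {E : ∀ i, Matrix (Fin (p i)) (Fin (p i)) ℝ}
    (h : ∀ i, Tendsto (fun x => D x i) f (𝓝 (E i))) :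
    Tendsto (fun x => blockDiagonal' (D x)) f (𝓝 (blockDiagonal' E)) := by
  have hcont : Continuous fun D : ∀ i, Matrix (Fin (p i)) (Fin (p i)) ℝ => blockDiagonal' D :=
    Continuous.matrix_blockDiagonal' continuous_id
  exact (hcont.tendsto E).comp (tendsto_pi_nhds.2 h)

lemma tendsto_matrix_mul {α ι κ l : Type*} [Fintype κ] {f : Filter α} {A : α → Matrix ι κ ℝ}
    {B : α → Matrix κ l ℝ} {A₀ : Matrix ι κ ℝ} {B₀ : Matrix κ l ℝ} (hA : Tendsto A f (𝓝 A₀))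
    (hB : Tendsto B f (𝓝 B₀)) : Tendsto (fun x => A x * B x) f (𝓝 (A₀ * B₀)) := by
  have hcont : Continuous fun z : Matrix ι κ ℝ × Matrix κ l ℝ => z.1 * z.2 := by fun_prop
  exact (hcont.tendsto (A₀, B₀)).comp (hA.prodMk_nhds hB)

end Stacking

/-! ### Joint limit of all agents and of the aggregated estimator. -/

section JointAsymptotics

variable {Ω : Type*} [MeasurableSpace Ω] {P : Measure Ω}
  {m d : ℕ} {p q : Fin m → ℕ} {e : ∀ i, Fin (p i) ⊕ Fin (q i) ≃ Fin d}
  {S : Matrix (Fin d) (Fin d) ℝ} {θ : Fin d → ℝ} {σ : ℝ≥0}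
  {x : Fin m → ℕ → Ω → EuclideanSpace ℝ (Fin d)} {ξ : Fin m → ℕ → Ω → ℝ}

/-- The scores of all agents, stacked. -/
def stackedScore (e : ∀ i, Fin (p i) ⊕ Fin (q i) ≃ Fin d)
    (S : Matrix (Fin d) (Fin d) ℝ) (θ : Fin d → ℝ)
    (x : Fin m → ℕ → Ω → EuclideanSpace ℝ (Fin d)) (ξ : Fin m → ℕ → Ω → ℝ) (j : ℕ) (ω : Ω) :
    (Σ i, Fin (p i)) → ℝ :=
  fun s => score (e s.1) S θ (x s.1) (ξ s.1) j ω s.2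

/-- The normalized estimation errors of all local least squares estimates, stacked. -/
def stackedError (e : ∀ i, Fin (p i) ⊕ Fin (q i) ≃ Fin d)
    (S : Matrix (Fin d) (Fin d) ℝ) (θ : Fin d → ℝ)
    (x : Fin m → ℕ → Ω → EuclideanSpace ℝ (Fin d)) (ξ : Fin m → ℕ → Ω → ℝ) (n : ℕ) (ω : Ω) :
    (Σ i, Fin (p i)) → ℝ :=
  fun s => (√(n : ℝ) • (localOLS (e s.1) θ (x s.1) (ξ s.1) n ω -
    transfer (e s.1) S *ᵥ θ)) s.2

lemma iIndepFun_agent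
    (hindep : iIndepFun (fun (s : Fin m × ℕ) (ω : Ω) => (x s.1 s.2 ω, ξ s.1 s.2 ω)) P)
    (i : Fin m) : iIndepFun (fun j ω => (x i j ω, ξ i j ω)) P :=
  hindep.precomp (g := fun j => (i, j)) fun _ _ h => (Prod.mk.inj h).2

lemma iIndepFun_sample
    (hindep : iIndepFun (fun (s : Fin m × ℕ) (ω : Ω) => (x s.1 s.2 ω, ξ s.1 s.2 ω)) P)
    (j : ℕ) : iIndepFun (fun i ω => (x i j ω, ξ i j ω)) P :=
  hindep.precomp (g := fun i => (i, j)) fun _ _ h => (Prod.mk.inj h).1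

variable [IsProbabilityMeasure P]

/-- The agents' contributions to a linear form are independent and centred, so their variances add.
This is why the joint covariance is block diagonal. -/
lemma integral_dotProduct_stackedScore_sq (hS : S.PosDef)
    (hx : ∀ i j, HasLaw (x i j) (multivariateGaussian 0 S) P)
    (hξ : ∀ i j, HasLaw (ξ i j) (gaussianReal 0 (σ ^ 2)) P)
    (hxξ : ∀ i j, IndepFun (x i j) (ξ i j) P)
    (hindep : iIndepFun (fun (s : Fin m × ℕ) (ω : Ω) => (x s.1 s.2 ω, ξ s.1 s.2 ω)) P)
    (t : (Σ i, Fin (p i)) → ℝ) :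
    ∫ ω, (t ⬝ᵥ stackedScore e S θ x ξ 0 ω) ^ 2 ∂P =
      t ⬝ᵥ (blockDiagonal' (fun i => residualVariance (e i) S θ σ • blockPP (e i) S) *ᵥ t) := by
  set U : Fin m → Ω → ℝ := fun i ω =>
    score (e i) S θ (x i) (ξ i) 0 ω ⬝ᵥ fun a => t ⟨i, a⟩ with hU
  have hsum (ω : Ω) : t ⬝ᵥ stackedScore e S θ x ξ 0 ω = ∑ i, U i ω := by
    rw [dotProduct, Fintype.sum_sigma]
    refine Finset.sum_congr rfl fun i _ => ?_
    simp only [hU]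
    rw [dotProduct_comm]
    rfl
  have hUL2 (i) : MemLp (U i) 2 P := memLp_score (e i) hS (hx i) (hξ i) (hxξ i) 0 _
  have hU0 (i) : ∫ ω, U i ω ∂P = 0 := integral_score (e i) hS (hx i) (hξ i) (hxξ i) 0 _
  have hUind : iIndepFun U P := by
    have := (iIndepFun_sample hindep 0).comp (fun i z =>
      (z.1.ofLp ⬝ᵥ extend (e i) fun a => t ⟨i, a⟩) *
        (z.1.ofLp ⬝ᵥ residualDirection (e i) S θ + z.2))
      fun i => Continuous.measurable (by fun_prop)
    convert this using 2 with i
    funext ω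
    exact score_dotProduct (e i) S θ (x i) (ξ i) 0 ω _
  have hvar := IndepFun.variance_sum (s := Finset.univ) (fun i _ => hUL2 i)
    fun i _ j _ hij => hUind.indepFun hij
  have hmean : ∫ ω, (∑ i, U i) ω ∂P = 0 := by
    simp only [Finset.sum_apply]
    rw [integral_finsetSum _ fun i _ => (hUL2 i).integrable (by norm_num)]
    simp [hU0]
  rw [variance_of_integral_eq_zero (Finset.aemeasurable_sum _ fun i _ =>
    (hUL2 i).aestronglyMeasurable.aemeasurable) hmean] at hvar
  simp_rw [hsum]
  simp only [Finset.sum_apply] at hvar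
  rw [hvar, dotProduct_blockDiagonal'_mulVec]
  refine Finset.sum_congr rfl fun i _ => ?_
  rw [variance_of_integral_eq_zero (hUL2 i).aestronglyMeasurable.aemeasurable (hU0 i)]
  exact integral_score_sq (e i) hS (hx i) (hξ i) (hxξ i) 0 _

/-- The joint central limit theorem for the scores of all agents. -/
lemma tendstoGaussian_stackedScore (hS : S.PosDef)
    (hpos : ∀ i, 0 < residualVariance (e i) S θ σ)
    (hx : ∀ i j, HasLaw (x i j) (multivariateGaussian 0 S) P)
    (hξ : ∀ i j, HasLaw (ξ i j) (gaussianReal 0 (σ ^ 2)) P)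
    (hxξ : ∀ i j, IndepFun (x i j) (ξ i j) P)
    (hindep : iIndepFun (fun (s : Fin m × ℕ) (ω : Ω) => (x s.1 s.2 ω, ξ s.1 s.2 ω)) P) :
    TendstoGaussian P
      (fun n ω => (√(n : ℝ))⁻¹ • ∑ j ∈ Finset.range n, stackedScore e S θ x ξ j ω)
      (blockDiagonal' fun i => residualVariance (e i) S θ σ • blockPP (e i) S) := by
  -- The stacked score at time j is g of the j-th samples of all agents, so it inherits independence
  -- and identical distribution over j.
  set g : (Fin m → EuclideanSpace ℝ (Fin d) × ℝ) → (Σ i, Fin (p i)) → ℝ := fun z s =>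
    ((z s.1).1.ofLp ⬝ᵥ residualDirection (e s.1) S θ + (z s.1).2) *
      (z s.1).1.ofLp (e s.1 (Sum.inl s.2)) with hg
  have hgm : Measurable g := Continuous.measurable (by fun_prop)
  have hmeas (j i) : AEMeasurable (fun ω => (x i j ω, ξ i j ω)) P :=
    (hx i j).aemeasurable.prodMk (hξ i j).aemeasurable
  -- The indices are swapped so that grouping runs over the sample number, each group holding all
  -- agents.
  have hrows : iIndepFun (fun j ω i => (x i j ω, ξ i j ω)) P :=
    iIndepFun_curry hmeas (hindep.precomp (g := Prod.swap) Prod.swap_injective)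
  have hrows_ident (j : ℕ) : IdentDistrib (fun ω i => (x i j ω, ξ i j ω))
      (fun ω i => (x i 0 ω, ξ i 0 ω)) P P :=
    IdentDistrib.pi (fun i => identDistrib_sample (hx i) (hξ i) (hxξ i) j)
      (iIndepFun_sample hindep j) (iIndepFun_sample hindep 0)
  have hsingle (ω : Ω) (s : Σ i, Fin (p i)) : stackedScore e S θ x ξ 0 ω s =
      score (e s.1) S θ (x s.1) (ξ s.1) 0 ω ⬝ᵥ Pi.single s.2 1 := by
    simp [stackedScore]
  refine tendstoGaussian_inv_sqrt_smul_sum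
    (blockDiagonal'_posSemidef fun i => ((blockPP_posDef (e i) hS).smul (hpos i)).posSemidef)
    (hrows.comp (fun _ => g) fun _ => hgm) (fun j => (hrows_ident j).comp hgm) (fun s => ?_)
    (fun s => ?_) (integral_dotProduct_stackedScore_sq hS hx hξ hxξ hindep)
  · simp_rw [hsingle]
    exact memLp_score (e s.1) hS (hx s.1) (hξ s.1) (hxξ s.1) 0 _
  · simp_rw [hsingle]
    exact integral_score (e s.1) hS (hx s.1) (hξ s.1) (hxξ s.1) 0 _

/-- Joint asymptotic normality of the local least squares estimates. -/
lemma tendstoGaussian_stackedError (hS : S.PosDef)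
    (hpos : ∀ i, 0 < residualVariance (e i) S θ σ)
    (hx : ∀ i j, HasLaw (x i j) (multivariateGaussian 0 S) P)
    (hξ : ∀ i j, HasLaw (ξ i j) (gaussianReal 0 (σ ^ 2)) P)
    (hxξ : ∀ i j, IndepFun (x i j) (ξ i j) P)
    (hindep : iIndepFun (fun (s : Fin m × ℕ) (ω : Ω) => (x s.1 s.2 ω, ξ s.1 s.2 ω)) P) :
    TendstoGaussian P (stackedError e S θ x ξ)
      (blockDiagonal' fun i => (gaussianWeight (e i) S θ σ)⁻¹) := by
  -- Sandwich form, blockwise Σ₊⁻¹(vΣ₊)Σ₊⁻¹ = vΣ₊⁻¹, matching the linear image of the score limit.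
  have hcov : (blockDiagonal' fun i => (gaussianWeight (e i) S θ σ)⁻¹) =
      blockDiagonal' (fun i => (blockPP (e i) S)⁻¹) *
        blockDiagonal' (fun i => residualVariance (e i) S θ σ • blockPP (e i) S) *
        (blockDiagonal' fun i => (blockPP (e i) S)⁻¹)ᵀ := by
    rw [blockDiagonal'_transpose, ← blockDiagonal'_mul, ← blockDiagonal'_mul]
    congr 1
    funext i
    have hunit := (blockPP_posDef (e i) hS).isUnit_det
    have ht : (blockPP (e i) S)⁻¹ᵀ = (blockPP (e i) S)⁻¹ := by
      simpa using (blockPP_posDef (e i) hS).inv.isHermitian.eq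
    rw [gaussianWeight_inv (e i) hS (hpos i), ht, Matrix.mul_smul, Matrix.smul_mul,
      nonsing_inv_mul _ hunit, Matrix.one_mul]
  have hlim : ∀ᵐ ω ∂P, ∀ i, Tendsto (fun n => localCov (e i) (x i) n ω) atTop
      (𝓝 (blockPP (e i) S)) :=
    ae_all_iff.2 fun i => tendsto_localCov_ae (e i) hS (hx i) (hξ i) (hxξ i)
      (iIndepFun_agent hindep i)
  rw [hcov]
  refine (tendstoGaussian_stackedScore hS hpos hx hξ hxξ hindep).mulVec_of_tendsto
    (blockDiagonal'_posSemidef fun i => ((blockPP_posDef (e i) hS).smul (hpos i)).posSemidef)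
    (A := fun n ω => blockDiagonal' fun i => (localCov (e i) (x i) n ω)⁻¹) ?_ ?_
    (fun n => ?_) ?_
  · rintro n ⟨i, a⟩ ⟨i', b⟩
    by_cases h : i = i'
    · subst h
      simp only [blockDiagonal'_apply_eq]
      exact aemeasurable_matrix_inv_apply
        (aemeasurable_localCov (e i) (fun j => (hx i j).aemeasurable) n) a b
    · simp only [blockDiagonal'_apply_ne _ _ _ h]
      exact aemeasurable_const
  · filter_upwards [hlim] with ω hω
    exact tendsto_blockDiagonal' fun i =>
      tendsto_matrix_inv (blockPP_posDef (e i) hS).isUnit_det (hω i)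
  · refine aemeasurable_pi_lambda _ fun s => ?_
    simp only [stackedError, Pi.smul_apply, Pi.sub_apply, smul_eq_mul]
    exact ((aemeasurable_localOLS (e s.1) θ (fun j => (hx s.1 j).aemeasurable)
      (fun j => (hξ s.1 j).aemeasurable) n s.2).sub_const _).const_mul _
  · filter_upwards [hlim] with ω hω
    have hdet : ∀ᶠ n in atTop, ∀ i, IsUnit (localCov (e i) (x i) n ω).det :=
      eventually_all.2 fun i =>
        eventually_isUnit_det_of_tendsto (blockPP_posDef (e i) hS).isUnit_det (hω i)
    filter_upwards [hdet, eventually_ne_atTop 0] with n hn hn0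
    have hsqrt : √(n : ℝ) * (n : ℝ)⁻¹ = (√(n : ℝ))⁻¹ := by
      rw [← div_eq_mul_inv, Real.sqrt_div_self]
    ext ⟨i, a⟩
    rw [stackedError]
    simp only
    rw [localOLS_sub_eq (e i) S θ (x i) (ξ i) hn0 (hn i), ← mulVec_smul, smul_smul, hsqrt]
    rw [blockDiagonal'_mulVec_apply]
    congr 2
    funext b
    simp [stackedScore]

/-- Asymptotic normality of the aggregated estimator for convergent data-dependent weights. -/
lemma tendstoNormal_aggregate (hcover : ∀ k, ∃ i a, e i (Sum.inl a) = k) (hS : S.PosDef)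
    (hpos : ∀ i, 0 < residualVariance (e i) S θ σ)
    (hx : ∀ i j, HasLaw (x i j) (multivariateGaussian 0 S) P)
    (hξ : ∀ i j, HasLaw (ξ i j) (gaussianReal 0 (σ ^ 2)) P)
    (hxξ : ∀ i j, IndepFun (x i j) (ξ i j) P)
    (hindep : iIndepFun (fun (s : Fin m × ℕ) (ω : Ω) => (x s.1 s.2 ω, ξ s.1 s.2 ω)) P)
    {What : ℕ → Ω → ∀ i, Matrix (Fin (p i)) (Fin (p i)) ℝ}
    {W : ∀ i, Matrix (Fin (p i)) (Fin (p i)) ℝ} (hW : ∀ i, (W i).PosDef)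
    (hWm : ∀ n i a b, AEMeasurable (fun ω => What n ω i a b) P)
    (hWlim : ∀ᵐ ω ∂P, Tendsto (fun n => What n ω) atTop (𝓝 W))
    (hWpos : ∀ᵐ ω ∂P, ∀ᶠ n in atTop, ∀ i, (What n ω i).PosDef)
    {est : ℕ → Ω → Fin d → ℝ}
    (hest : IsAggregate P e S What (fun n ω i => localOLS (e i) θ (x i) (ξ i) n ω) est) :
    TendstoNormal P (fun n ω => √(n : ℝ) • (est n ω - θ)) (aggregateCov e S θ σ W) := by
  -- C(W) is the covariance of the block row [B₁ ⋯ Bₘ] applied to the stacked limit.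
  have hcov : aggregateCov e S θ σ W =
      blockRow (fun i => (information e S W)⁻¹ * ((transfer (e i) S)ᵀ * W i)) *
        blockDiagonal' (fun i => (gaussianWeight (e i) S θ σ)⁻¹) *
        (blockRow fun i => (information e S W)⁻¹ * ((transfer (e i) S)ᵀ * W i))ᵀ := by
    rw [aggregateCov_eq_sum e S θ σ fun i => (hW i).isHermitian, blockRow_mul_blockDiagonal',
      blockRow_mul_transpose]
  rw [hcov]
  refine (tendstoGaussian_stackedError hS hpos hx hξ hxξ hindep).mulVec_of_tendsto
    (blockDiagonal'_posSemidef fun i =>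
      (gaussianWeight_posDef (e i) hS (hpos i)).inv.posSemidef)
    (A := fun n ω => blockRow fun i =>
      (information e S (What n ω))⁻¹ * ((transfer (e i) S)ᵀ * What n ω i)) ?_ ?_
    (fun n => ?_) ?_
  · intro n k s
    have hTW (i) (k : Fin d) (a : Fin (p i)) :
        AEMeasurable (fun ω => ((transfer (e i) S)ᵀ * What n ω i) k a) P :=
      aemeasurable_matrix_mul_apply (A := fun _ => (transfer (e i) S)ᵀ)
        (fun _ _ => aemeasurable_const) (hWm n i) k a
    refine aemeasurable_matrix_mul_apply (aemeasurable_matrix_inv_apply fun k l => ?_)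
      (hTW s.1) k s.2
    simp_rw [information, Matrix.sum_apply]
    exact Finset.aemeasurable_fun_sum _ fun i _ =>
      aemeasurable_matrix_mul_apply (B := fun _ => transfer (e i) S) (hTW i)
        (fun _ _ => aemeasurable_const) k l
  · filter_upwards [hWlim] with ω hω
    have hω' (i) : Tendsto (fun n => What n ω i) atTop (𝓝 (W i)) := tendsto_pi_nhds.1 hω i
    have hTW (i) := tendsto_matrix_mul (tendsto_const_nhds (x := (transfer (e i) S)ᵀ)) (hω' i)
    have hinfo : Tendsto (fun n => information e S (What n ω)) atTop (𝓝 (information e S W)) :=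
      tendsto_finsetSum _ fun i _ => tendsto_matrix_mul (hTW i) tendsto_const_nhds
    exact tendsto_blockRow fun i => tendsto_matrix_mul
      (tendsto_matrix_inv (information_posDef hcover hS hW).isUnit_det hinfo) (hTW i)
  · exact ((hest.aemeasurable n).sub_const θ).const_smul (√(n : ℝ))
  · filter_upwards [hWpos, ae_all_iff.2 hest.minimizes] with ω hω hmin
    filter_upwards [hω] with n hn
    -- Once the weights are positive definite, the estimator must equal the closed form, whose error
    -- is linear in the local errors.
    rw [(isRiskMinimizer_iff hcover hS hn _ _).1 (hmin n hn),
      aggregate_sub_eq hcover hS hn, Finset.smul_sum]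
    rw [blockRow_mulVec]
    refine Finset.sum_congr rfl fun i _ => ?_
    rw [← mulVec_smul]
    rfl

/-- Asymptotic normality of the local least squares estimates. -/
lemma tendstoNormal_localOLS (hS : S.PosDef)
    (hpos : ∀ i, 0 < residualVariance (e i) S θ σ)
    (hx : ∀ i j, HasLaw (x i j) (multivariateGaussian 0 S) P)
    (hξ : ∀ i j, HasLaw (ξ i j) (gaussianReal 0 (σ ^ 2)) P)
    (hxξ : ∀ i j, IndepFun (x i j) (ξ i j) P)
    (hindep : iIndepFun (fun (s : Fin m × ℕ) (ω : Ω) => (x s.1 s.2 ω, ξ s.1 s.2 ω)) P)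
    (i : Fin m) :
    TendstoNormal P (fun n ω => √(n : ℝ) •
      (localOLS (e i) θ (x i) (ξ i) n ω - transfer (e i) S *ᵥ θ))
      (gaussianWeight (e i) S θ σ)⁻¹ := by
  have h := (tendstoGaussian_stackedError hS hpos hx hξ hxξ hindep).mulVec
    (blockDiagonal'_posSemidef fun i =>
      (gaussianWeight_posDef (e i) hS (hpos i)).inv.posSemidef)
    -- The 0-1 matrix that selects the i-th block of the stacked vector.
    ((1 : Matrix (Σ i, Fin (p i)) (Σ i, Fin (p i)) ℝ).submatrix
      (fun a : Fin (p i) => (⟨i, a⟩ : Σ i, Fin (p i))) id)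
  convert! h using 1
  · funext n ω a
    simp [mulVec, dotProduct, Matrix.one_apply, stackedError]
  · ext a b
    simp [Matrix.mul_apply, Matrix.one_apply]

end JointAsymptotics

end Collab

end

/-! ### The main theorem. -/

theorem mainTheorem2 {Ω : Type*} [MeasurableSpace Ω] (P : Measure Ω) [IsProbabilityMeasure P]
    {m d : ℕ} {p q : Fin m → ℕ}
    -- the agents' views; every feature is observed by some agent
    (e : ∀ i, Fin (p i) ⊕ Fin (q i) ≃ Fin d)
    (hcover : ∀ k, ∃ i a, e i (Sum.inl a) = k)
    -- population covariance, ground truth, noise level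
    (S : Matrix (Fin d) (Fin d) ℝ) (hS : S.PosDef)
    (θ : Fin d → ℝ) (σ : ℝ≥0)
    (hpos : ∀ i, 0 < Collab.residualVariance (e i) S θ σ)
    -- agent `i` has features `x i j` and noise `ξ i j`, `j = 0, 1, 2, …`
    (x : Fin m → ℕ → Ω → EuclideanSpace ℝ (Fin d)) (ξ : Fin m → ℕ → Ω → ℝ)
    (hx : ∀ i j, HasLaw (x i j) (multivariateGaussian 0 S) P)
    (hξ : ∀ i j, HasLaw (ξ i j) (gaussianReal 0 (σ ^ 2)) P)
    (hxξ : ∀ i j, IndepFun (x i j) (ξ i j) P)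
    (hindep : iIndepFun
      (fun (s : Fin m × ℕ) (ω : Ω) => (x s.1 s.2 ω, ξ s.1 s.2 ω)) P) :
    -- asymptotic normality of the global and local Collab estimators, for plug-in weights built
    -- from the sample covariance or from the known covariance of the observed features
    (∀ Shat : ℕ → Ω → ∀ i, Matrix (Fin (p i)) (Fin (p i)) ℝ,
      (Shat = (fun n ω i =>
          Collab.sampleCov (Collab.obsData (e i) (Collab.dataMatrix (x i) n ω))) ∨
        Shat = fun _ _ i => Collab.blockPP (e i) S) →
      Tendsto (fun n => P {ω | ∀ i,
        ((Collab.localError (e i) θ (x i) (ξ i) n ω)⁻¹ • Shat n ω i).PosDef}) atTop (𝓝 1) ∧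
      ∀ est : ℕ → Ω → Fin d → ℝ,
        Collab.IsAggregate P e S
          (fun n ω i => (Collab.localError (e i) θ (x i) (ξ i) n ω)⁻¹ • Shat n ω i)
          (fun n ω i => Collab.localOLS (e i) θ (x i) (ξ i) n ω) est →
        Collab.TendstoNormal P (fun n ω => √(n : ℝ) • (est n ω - θ))
          (Collab.gaussianCov e S θ σ) ∧
        ∀ i, Collab.TendstoNormal P
          (fun n ω => √(n : ℝ) •
            (Collab.transfer (e i) S *ᵥ est n ω - Collab.transfer (e i) S *ᵥ θ))
          (Collab.transfer (e i) S * Collab.gaussianCov e S θ σ *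
            (Collab.transfer (e i) S)ᵀ)) ∧
    -- (i) for fixed weights the aggregated estimator is well defined and asymptotically normal
    -- with covariance `C(W)`, which is minimal at the weights `Wᵍ`
    (∀ W : ∀ i, Matrix (Fin (p i)) (Fin (p i)) ℝ, (∀ i, (W i).PosDef) →
      (Collab.information e S W).PosDef ∧
      (∀ b : ∀ i, Fin (p i) → ℝ, ∃! t, Collab.IsRiskMinimizer e S W b t) ∧
      (∀ est : ℕ → Ω → Fin d → ℝ,
        Collab.IsAggregate P e S (fun _ _ => W)
          (fun n ω i => Collab.localOLS (e i) θ (x i) (ξ i) n ω) est →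
        Collab.TendstoNormal P (fun n ω => √(n : ℝ) • (est n ω - θ))
          (Collab.aggregateCov e S θ σ W)) ∧
      (Collab.aggregateCov e S θ σ W -
        Collab.aggregateCov e S θ σ (fun i => Collab.gaussianWeight (e i) S θ σ)).PosSemidef) ∧
    (∀ i, (Collab.gaussianWeight (e i) S θ σ).PosDef) ∧
    Collab.aggregateCov e S θ σ (fun i => Collab.gaussianWeight (e i) S θ σ) =
      Collab.gaussianCov e S θ σ ∧
    -- (ii) the local least squares estimates are asymptotically normal, with a covariance that
    -- dominates that of the local Collab estimator
    ∀ i,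
      Collab.TendstoNormal P
        (fun n ω => √(n : ℝ) •
          (Collab.localOLS (e i) θ (x i) (ξ i) n ω - Collab.transfer (e i) S *ᵥ θ))
        (Collab.gaussianWeight (e i) S θ σ)⁻¹ ∧
      ((Collab.gaussianWeight (e i) S θ σ)⁻¹ -
        Collab.transfer (e i) S * Collab.gaussianCov e S θ σ *
          (Collab.transfer (e i) S)ᵀ).PosSemidef := by
  have hxm (i j) : AEMeasurable (x i j) P := (hx i j).aemeasurable
  have hξm (i j) : AEMeasurable (ξ i j) P := (hξ i j).aemeasurable
  have hW (i) := Collab.gaussianWeight_posDef (e i) hS (hpos i)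
  have hcovg := Collab.aggregateCov_gaussianWeight hcover hS hpos
  have hR : ∀ᵐ ω ∂P, ∀ i, Tendsto (fun n => Collab.localError (e i) θ (x i) (ξ i) n ω) atTop
      (𝓝 (Collab.residualVariance (e i) S θ σ)) :=
    ae_all_iff.2 fun i => Collab.tendsto_localError_ae (e i) hS (hx i) (hξ i) (hxξ i)
      (Collab.iIndepFun_agent hindep i)
  refine ⟨fun Shat hShat => ?_, fun W hWpos => ⟨Collab.information_posDef hcover hS hWpos,
    fun b => ?_, fun est hest => ?_, ?_⟩, hW, hcovg, fun i =>
    ⟨Collab.tendstoNormal_localOLS hS hpos hx hξ hxξ hindep i,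
      Collab.gaussianWeight_inv_sub_posSemidef hcover hS hpos i⟩⟩
  · have hlim : ∀ᵐ ω ∂P, ∀ i, Tendsto (fun n => Shat n ω i) atTop
        (𝓝 (Collab.blockPP (e i) S)) := by
      rcases hShat with rfl | rfl
      · exact ae_all_iff.2 fun i => Collab.tendsto_localCov_ae (e i) hS (hx i) (hξ i) (hxξ i)
          (Collab.iIndepFun_agent hindep i)
      · exact ae_of_all _ fun _ _ => tendsto_const_nhds
    have hmeas (n i a b) : AEMeasurable (fun ω => Shat n ω i a b) P := by
      rcases hShat with rfl | rfl
      · exact Collab.aemeasurable_localCov (e i) (hxm i) n a b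
      · exact aemeasurable_const
    have hpsd (n ω i) : (Shat n ω i).PosSemidef := by
      rcases hShat with rfl | rfl
      · exact Collab.sampleCov_posSemidef _
      · exact (Collab.blockPP_posDef (e i) hS).posSemidef
    -- Eventually the training error is positive and the covariance factor invertible, since both
    -- limits are. A positive semidefinite invertible matrix is positive definite.
    have hpd : ∀ᵐ ω ∂P, ∀ᶠ n in atTop, ∀ i,
        ((Collab.localError (e i) θ (x i) (ξ i) n ω)⁻¹ • Shat n ω i).PosDef := by
      filter_upwards [hR, hlim] with ω hRω hω
      refine eventually_all.2 fun i => ?_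
      filter_upwards [(hRω i).eventually_const_lt (hpos i),
        Collab.eventually_isUnit_det_of_tendsto (Collab.blockPP_posDef (e i) hS).isUnit_det
          (hω i)] with n hn hdet
      exact ((hpsd n ω i).posDef_iff_isUnit.2 ((Matrix.isUnit_iff_isUnit_det _).2 hdet)).smul
        (inv_pos.2 hn)
    refine ⟨Collab.tendsto_measure_one_of_ae_eventually hpd, fun est hest => ?_⟩
    have hnormal : Collab.TendstoNormal P (fun n ω => √(n : ℝ) • (est n ω - θ))
        (Collab.gaussianCov e S θ σ) := by
      rw [← hcovg]
      refine Collab.tendstoNormal_aggregate hcover hS hpos hx hξ hxξ hindep hW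
        (fun n i a b => ?_) ?_ hpd hest
      · exact (Collab.aemeasurable_localError (e i) θ (hxm i) (hξm i) n).inv.mul (hmeas n i a b)
      · filter_upwards [hR, hlim] with ω hRω hω
        exact tendsto_pi_nhds.2 fun i => ((hRω i).inv₀ (hpos i).ne').smul (hω i)
    refine ⟨hnormal, fun i => ?_⟩
    -- The local estimator is a fixed linear image of the global one.
    have h := Collab.TendstoGaussian.mulVec
      (Collab.gaussianCov_posDef hcover hS hpos).posSemidef hnormal (Collab.transfer (e i) S)
    simp_rw [Matrix.mulVec_smul, Matrix.mulVec_sub] at h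
    exact h
  · exact ⟨Collab.aggregate e S W b, (Collab.isRiskMinimizer_iff hcover hS hWpos b _).2 rfl,
      fun t ht => (Collab.isRiskMinimizer_iff hcover hS hWpos b t).1 ht⟩
  · exact Collab.tendstoNormal_aggregate hcover hS hpos hx hξ hxξ hindep
      (What := fun _ _ => W) hWpos (fun _ _ _ _ => aemeasurable_const)
      (ae_of_all _ fun _ => tendsto_const_nhds)
      (ae_of_all _ fun _ => Eventually.of_forall fun _ => hWpos) hest
  · rw [hcovg]
    exact Collab.aggregateCov_sub_gaussianCov_posSemidef hcover hS hpos hWpos
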